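/- Let $g_o$ be the standard metric of the unit sphere $S^2\subset\mathbb R^3$, $\omega$ its area form, $h:S^2\to(0,\infty)$ a smooth function and $g=h^2g_o$, with geodesic distance $d$, area form $\Omega_g=h^2\omega$ and Laplace–Beltrami operator $\Delta_g$. The symplectic gradient is defined by $\Omega_g(\mathrm{sgrad} f,\cdot)=df$, and the Hamiltonian vector field $X$ of a pair $(\Omega,F)$ by $\Omega(X,\cdot)=dF$. Consider $N$ point vortices of strengths $\kappa_1,\dots,\kappa_N\neq0$ with $\sum_j\kappa_j=0$. For pairwise distinct $s_1,\dots,s_N\in S^2$ let $\psi$ be a stream function of the vorticity $\sum_j\kappa_j\delta_{s_j}$: $\psi$ is smooth with $\Delta_g\psi=0$ on $S^2\setminus\{s_1,\dots,s_N\}$, and $\psi-\kappa_j\frac{\log d(\cdot,s_j)}{2\pi}$ is bounded near $s_j$. Each vortex moves with the flow of the others together with its own drift, i.e. the velocity of the $j$-th vortex is the value at $s_j$ of $\mathrm{sgrad}$ of the desingularized stream function $\psi-\kappa_j\frac{\log d(\cdot,s_j)}{2\pi}$, extended to $s_j$ by its limit. Then these velocities are well defined (a stream function exists, its desingularizations have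 limits at the vortices and are differentiable there, and the velocities do not depend on the choice of $\psi$), and on collision-free configurations the vortex dynamics is the Hamiltonian system of $$\Omega=\sum_j\kappa_j\,h^2(s_j)\,\omega(s_j),\qquad \frac1{2\pi}H,\qquad H=\frac14\sum_{j\neq\ell}\kappa_j\kappa_\ell\log\bigl(h(s_j)h(s_\ell)\,|s_j-s_\ell|^2\bigr).$$ Here $\Omega$ is a symplectic form on $S^2\times\dots\times S^2$, $H$ is smooth off the collisions, the sum runs over ordered pairs $(j,\ell)$ with $j\neq\ell$, and $|s_j-s_\ell|$ is the Euclidean distance in $\mathbb R^3$. (The constant $\frac1{2\pi}$ only rescales time; it disappears if the stream function of a unit vortex is normalized as $\log d$ instead of $\frac1{2\pi}\log d$.) Moreover, $\frac1{2\pi}H$ is the collective vortex Hamiltonian of $g$: let $G$ be the Green function of $\Delta_g$, that is, $G$ is symmetric, smooth off the diagonal, $\Delta_gG(\cdot,r)=-1/\mathrm{Area}(g)$ on $S^2\setminus\{r\}$, $G(\cdot,r)-\frac{\log d(\cdot,r)}{2\pi}$ is bounded, and $\int_{S^2}G(p,q)\,\Omega_g(q)=0$. Then the Robin function $R(s)=\lim_{r\to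 s}\bigl(G(r,s)-\frac{\log d(r,s)}{2\pi}\bigr)$ exists, and for pairwise distinct $s_1,\dots,s_N$ the function $\sum_j\kappa_jG(\cdot,s_j)$ is a stream function as above and $$\sum_{i<j}\kappa_i\kappa_jG(s_i,s_j)+\sum_i\tfrac12\kappa_i^2R(s_i)=\frac1{2\pi}H(s_1,\dots,s_N).$$ -/

import Mathlib

open scoped Manifold ContDiff Topology

noncomputable section

namespace Vortex

/-- Euclidean three-space. -/
abbrev E3 : Type := EuclideanSpace ℝ (Fin 3)

/-- The unit sphere in Euclidean three-space, with Mathlib's topology and manifold structure. -/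
abbrev S2 : Type := Metric.sphere (0 : E3) 1

/-- Ordered configurations of `N` points of the sphere (collisions are not excluded here). -/
abbrev Config (N : ℕ) : Type := Fin N → S2

/-! ### Calculus on the round sphere

The tangent plane at `s` is the orthogonal complement of `s`. A function (or vector field) on the
sphere is differentiated after extending it to `ℝ³ \ {0}` so as to be constant along rays. -/

/-- The radial retraction `x ↦ x / |x|` of `ℝ³ \ {0}` onto the sphere (a fixed point of the sphere
is used as the irrelevant value at `x = 0`). -/
def retract (x : E3) : S2 :=
  if hx : x = 0 then ⟨EuclideanSpace.single 0 1, by simp⟩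
  else ⟨‖x‖⁻¹ • x, by simp [norm_smul, hx]⟩

/-- `u` is tangent to the sphere at `s`. -/
def IsTangent (s : S2) (u : E3) : Prop := inner ℝ (s : E3) u = 0

/-- The cross product of `ℝ³`. -/
def cross (u v : E3) : E3 := WithLp.toLp 2 (crossProduct u.ofLp v.ofLp)

/-- The area form `ω_s(u, v) = ⟨s, u × v⟩ = det (s, u, v)` of the round sphere. -/
def omega (s : S2) (u v : E3) : ℝ := inner ℝ (s : E3) (cross u v)

/-- The gradient of `f` at `s` for the round metric. -/
def sphereGrad (f : S2 → ℝ) (s : S2) : E3 := gradient (fun x : E3 => f (retract x)) (s : E3)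

/-- The divergence of the tangential vector field `X` at `s` for the round metric. -/
def sphereDiv (X : S2 → E3) (s : S2) : ℝ :=
  LinearMap.trace ℝ E3 (fderiv ℝ (fun x : E3 => X (retract x)) (s : E3)).toLinearMap

/-- The area measure of the round sphere (of total mass `4π`). -/
def sphereArea : MeasureTheory.Measure S2 := (MeasureTheory.volume : MeasureTheory.Measure E3).toSphere

/-! ### The conformal metric `g = h² g_o` -/

/-- The metric `g = h² g_o`. -/
def metric (h : S2 → ℝ) (s : S2) (u v : E3) : ℝ := h s ^ 2 * inner ℝ u v

/-- The area form of `g`, which is `h² ω`. -/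
def areaForm (h : S2 → ℝ) (s : S2) (u v : E3) : ℝ := h s ^ 2 * omega s u v

/-- The rotation `J` by 90 degrees in the tangent plane at `s`; the sense of rotation is the one
for which `g(u, v) = Ω_g(J u, v)`, see `metric_eq_areaForm`. -/
def rot (s : S2) (u : E3) : E3 := cross u (s : E3)

theorem metric_eq_areaForm (h : S2 → ℝ) (s : S2) (u v : E3) (hv : IsTangent s v) :
    metric h s u v = areaForm h s (rot s u) v := by
  have hs : inner ℝ (s : E3) (s : E3) = 1 := by
    rw [real_inner_self_eq_norm_sq]; simp
  unfold metric areaForm omega rot cross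
  unfold IsTangent at hv
  simp only [PiLp.inner_apply, Fin.sum_univ_three, crossProduct, RCLike.inner_apply, conj_trivial,
    LinearMap.mk₂_apply, Matrix.cons_val_zero, Matrix.cons_val_one, Matrix.cons_val] at hs hv ⊢
  congr 1
  linear_combination (-(u 0 * v 0 + u 1 * v 1 + u 2 * v 2)) * hs
    + (u 0 * s.1 0 + u 1 * s.1 1 + u 2 * s.1 2) * hv

/-- The gradient for `g`: `g(grad f, v) = df(v)`. -/
def grad (h : S2 → ℝ) (f : S2 → ℝ) (s : S2) : E3 := (h s ^ 2)⁻¹ • sphereGrad f s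

/-- The symplectic gradient `J (grad f)` for `g`: it satisfies `Ω_g(sgrad f, v) = df(v)`. -/
def sgrad (h : S2 → ℝ) (f : S2 → ℝ) (s : S2) : E3 := rot s (grad h f s)

/-- The divergence for `g`, i.e. for the area form `h² ω`. -/
def divergence (h : S2 → ℝ) (X : S2 → E3) (s : S2) : ℝ :=
  (h s ^ 2)⁻¹ * sphereDiv (fun r => h r ^ 2 • X r) s

/-- The Laplace-Beltrami operator `div ∘ grad` of `g`. -/
def laplaceBeltrami (h : S2 → ℝ) (f : S2 → ℝ) (s : S2) : ℝ := divergence h (grad h f) s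

/-- The total area of `g`. -/
def totalArea (h : S2 → ℝ) : ℝ := ∫ s, h s ^ 2 ∂sphereArea

/-- The geodesic distance of `g`: the infimum of the `g`-lengths of the `C¹` curves from `p` to
`q` on the sphere. -/
def geoDist (h : S2 → ℝ) (p q : S2) : ℝ :=
  sInf {L : ℝ | ∃ c : ℝ → S2, ContDiffOn ℝ 1 (fun t => (c t : E3)) (Set.Icc 0 1) ∧
    c 0 = p ∧ c 1 = q ∧
    L = ∫ t in (0 : ℝ)..1, h (c t) * ‖derivWithin (fun t => (c t : E3)) (Set.Icc 0 1) t‖}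

/-! ### Green and Robin functions, the collective Hamiltonian -/

/-- `G` is the Green function of the Laplace-Beltrami operator of `g` (values on the diagonal are
irrelevant). -/
structure IsGreenFunction (h : S2 → ℝ) (G : S2 → S2 → ℝ) : Prop where
  smooth : ContMDiffOn ((𝓡 2).prod (𝓡 2)) 𝓘(ℝ, ℝ) ∞ (fun p : S2 × S2 => G p.1 p.2)
    {p : S2 × S2 | p.1 ≠ p.2}
  laplacian : ∀ r s : S2, s ≠ r → laplaceBeltrami h (fun q => G q r) s = -(1 / totalArea h)
  singularity : ∀ r : S2, ∃ C : ℝ, ∀ s : S2, s ≠ r →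
    |G s r - Real.log (geoDist h s r) / (2 * Real.pi)| ≤ C
  mean_zero : ∀ p : S2, ∫ q, G p q * h q ^ 2 ∂sphereArea = 0
  symm : ∀ s r : S2, G s r = G r s

/-- `R` is the value at `s` of the Robin function belonging to the Green function `G`. -/
def IsRobinValue (h : S2 → ℝ) (G : S2 → S2 → ℝ) (s : S2) (R : ℝ) : Prop :=
  Filter.Tendsto (fun r => G r s - Real.log (geoDist h r s) / (2 * Real.pi)) (𝓝[≠] s) (𝓝 R)

/-- The collective Hamiltonian `∑_{i<j} κ_i κ_j G(s_i, s_j) + ∑_i ½ κ_i² R(s_i)` of point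
vortices, for a Green function `G` with Robin function `R`. -/
def collectiveHamiltonian {N : ℕ} (κ : Fin N → ℝ) (G : S2 → S2 → ℝ) (R : S2 → ℝ)
    (σ : Config N) : ℝ :=
  (∑ j, ∑ i ∈ Finset.univ.filter (fun i => i < j), κ i * κ j * G (σ i) (σ j))
    + ∑ i, 1 / 2 * κ i ^ 2 * R (σ i)

/-! ### Motion of point vortices of total vorticity zero -/

/-- `ψ` is a stream function of the vorticity `∑_j κ_j δ_{σ_j}` (without background vorticity) for
`g`: it is harmonic off the vortices and behaves like `κ_j log d(·, σ_j) / 2π` at `σ_j`. -/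
structure IsStreamFunction {N : ℕ} (h : S2 → ℝ) (κ : Fin N → ℝ) (σ : Config N)
    (ψ : S2 → ℝ) : Prop where
  smooth : ContMDiffOn (𝓡 2) 𝓘(ℝ, ℝ) ∞ ψ {s : S2 | ∀ j, s ≠ σ j}
  harmonic : ∀ s : S2, (∀ j, s ≠ σ j) → laplaceBeltrami h ψ s = 0
  singularity : ∀ j, ∃ C : ℝ, ∀ᶠ s in 𝓝[≠] (σ j),
    |ψ s - κ j * (Real.log (geoDist h s (σ j)) / (2 * Real.pi))| ≤ C

/-- `ρ` is the desingularization of the stream function `ψ` at the vortex `σ_j`: it is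
`ψ - κ_j log d(·, σ_j) / 2π` off `σ_j`, and its value at `σ_j` is the limit of this. -/
def IsDesingularization {N : ℕ} (h : S2 → ℝ) (κ : Fin N → ℝ) (σ : Config N) (ψ : S2 → ℝ)
    (j : Fin N) (ρ : S2 → ℝ) : Prop :=
  (∀ s, s ≠ σ j → ρ s = ψ s - κ j * (Real.log (geoDist h s (σ j)) / (2 * Real.pi))) ∧
    Filter.Tendsto ρ (𝓝[≠] (σ j)) (𝓝 (ρ (σ j)))

/-- `X` is the velocity of the point vortices at the configuration `σ`: each vortex moves with the
symplectic gradient, at its own position, of the stream function desingularized there. This is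
the flow of all the other vortices together with the vortex' own drift. -/
def IsVortexVelocity {N : ℕ} (h : S2 → ℝ) (κ : Fin N → ℝ) (σ : Config N)
    (X : Fin N → E3) : Prop :=
  ∃ ψ : S2 → ℝ, IsStreamFunction h κ σ ψ ∧ ∀ j, ∃ ρ : S2 → ℝ,
    IsDesingularization h κ σ ψ j ρ ∧
    DifferentiableAt ℝ (fun x : E3 => ρ (retract x)) (σ j : E3) ∧
    X j = sgrad h ρ (σ j)

/-! ### Hamiltonian systems on `S² × ⋯ × S²` -/

/-- `ξ` is tangent to `S² × ⋯ × S²` at `σ`. -/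
def IsTangentVector {N : ℕ} (σ : Config N) (ξ : Fin N → E3) : Prop := ∀ j, IsTangent (σ j) (ξ j)

/-- The inclusion of the configurations in `(ℝ³)^N`. -/
def incl {N : ℕ} (σ : Config N) : Fin N → E3 := fun j => (σ j : E3)

/-- The componentwise radial retraction to `S² × ⋯ × S²`. -/
def retractAll {N : ℕ} (x : Fin N → E3) : Config N := fun j => retract (x j)

/-- The differential at `σ` of a function on `S² × ⋯ × S²`. -/
def differential {N : ℕ} (F : Config N → ℝ) (σ : Config N) : (Fin N → E3) →L[ℝ] ℝ :=
  fderiv ℝ (fun x : Fin N → E3 => F (retractAll x)) (incl σ)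

/-- `Ω` is (given by restriction to tangent vectors) a symplectic form on `S² × ⋯ × S²`:
a smooth, closed and nondegenerate 2-form. -/
structure IsSymplecticForm {N : ℕ} (Ω : Config N → (Fin N → E3) → (Fin N → E3) → ℝ) : Prop where
  add_left : ∀ σ ξ ξ' η, Ω σ (ξ + ξ') η = Ω σ ξ η + Ω σ ξ' η
  smul_left : ∀ σ (a : ℝ) ξ η, Ω σ (a • ξ) η = a * Ω σ ξ η
  skew : ∀ σ ξ η, Ω σ ξ η = -Ω σ η ξ
  smooth : ∀ σ ξ η, ContDiffAt ℝ ∞ (fun x => Ω (retractAll x) ξ η) (incl σ)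
  closed : ∀ σ ξ η ζ, IsTangentVector σ ξ → IsTangentVector σ η → IsTangentVector σ ζ →
    differential (fun τ => Ω τ η ζ) σ ξ - differential (fun τ => Ω τ ξ ζ) σ η
      + differential (fun τ => Ω τ ξ η) σ ζ = 0
  nondegenerate : ∀ σ ξ, IsTangentVector σ ξ →
    (∀ η, IsTangentVector σ η → Ω σ ξ η = 0) → ξ = 0

/-- `X` is the value at `σ` of the Hamiltonian vector field of `(Ω, H)`: `Ω(X, ·) = dH`. -/
def IsHamiltonianVector {N : ℕ} (Ω : Config N → (Fin N → E3) → (Fin N → E3) → ℝ)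
    (H : Config N → ℝ) (σ : Config N) (X : Fin N → E3) : Prop :=
  IsTangentVector σ X ∧ ∀ η, IsTangentVector σ η → Ω σ X η = differential H σ η

/-- `γ` moves, at the times in `I`, without collisions and with velocities given by the vector
field `V` (written as a relation). -/
def IsMotion {N : ℕ} (V : Config N → (Fin N → E3) → Prop) (γ : ℝ → Config N)
    (I : Set ℝ) : Prop :=
  ∀ t ∈ I, Function.Injective (γ t) ∧ ∃ X : Fin N → E3, V (γ t) X ∧
    ∀ j, HasDerivAt (fun τ => (γ τ j : E3)) (X j) t

/-- The 2-form `Ω = ∑_j κ_j h²(s_j) ω(s_j)`. -/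
def vortexForm {N : ℕ} (h : S2 → ℝ) (κ : Fin N → ℝ) (σ : Config N) (ξ η : Fin N → E3) : ℝ :=
  ∑ j, κ j * (h (σ j) ^ 2 * omega (σ j) (ξ j) (η j))

/-- `H = ¼ ∑'_{j,l} κ_j κ_l log (h(s_j) h(s_l) |s_j - s_l|²)`, with the Euclidean distance of
`ℝ³`; the sum is over the ordered pairs with `j ≠ l`. -/
def sphereHamiltonian {N : ℕ} (h : S2 → ℝ) (κ : Fin N → ℝ) (σ : Config N) : ℝ :=
  1 / 4 * ∑ j, ∑ l ∈ Finset.univ.filter (fun l => l ≠ j),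
    κ j * κ l * Real.log (h (σ j) * h (σ l) * ‖(σ j : E3) - (σ l : E3)‖ ^ 2)

end Vortex

end

/-!
The velocity of a vortex and the differential of `H` are both computed from an explicit stream
function, and everything rests on three facts.

* *Conformal invariance.* In dimension two `Δ_g = h⁻² Δ_{g_o}` (`laplaceBeltrami_eq`), so harmonic
  functions of `g` are those of the round metric. There `log |s - p|` has the constant Laplacian
  `-1/2` off `p` (`sphereLaplacian_logDist`), and for strengths of sum zero the function
  `ψ = ∑ κ_j log |s - s_j| / 2π` is harmonic off the vortices.

* *Rigidity.* A harmonic function on the sphere minus finitely many points which is bounded near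
  each of them is constant (`eq_of_sphereLaplacian_eq_zero`). This is proved by the maximum
  principle alone, with a barrier built from logarithms of distances. It makes `ψ` the only stream
  function up to constants, and it determines a Green function `G` off the diagonal: the regular
  part `G(s, r) - log |s - r| / 2π` with two poles `r`, `r'` differs by a constant, whence by
  symmetry it is `(L(s) + L(r)) / 2`, with `L` its limit on the diagonal
  (`IsGreenFunction.exists_greenRegular_eq`).

* *Short geodesics.* `log d(s, p) = log (√(h(s) h(p)) |s - p|) + o(|s - p|)`
  (`isLittleO_log_geoDist`). The upper bound for `d` is the length of the great circle arc. The
  lower bound is a calibration: if `h ≈ h(p) + ⟨a, y⟩` near `p`, with `y` the displacement from `p`,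
  and `u` is the direction of `s`, then the gradient of
  `φ(y) = h(p) ⟨u, y⟩ + ⟨a, y⟩ ⟨u, y⟩ - ½ ⟨a, u⟩ ⟨u, y⟩²` has norm at most
  `h(p) + ⟨a, y⟩ + O(|y|²)`, so that no curve from `s` to `p` is much shorter than `φ(s) - φ(p)`.

By the last fact the stream function `ψ` desingularized at `s_j` has at `s_j` the differential of
`∑_{l ≠ j} κ_l log |s - s_l| / 2π - κ_j log h(s) / 4π`. Since `∑_{l ≠ j} κ_l = -κ_j`, its `κ_j`-fold
is also the partial differential of `H / 2π` (`differential_sphereHamiltonian`), and the symplectic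
gradient turns this into Hamilton's equation (`isHamiltonianVector_iff`). In the collective
Hamiltonian the terms with `L` cancel, again because the strengths add up to zero
(`collectiveHamiltonian_eq`).
-/

noncomputable section

namespace Vortex

/-! ### The radial retraction and smoothness on the sphere -/

theorem norm_coe_S2 (s : S2) : ‖(s : E3)‖ = 1 := norm_eq_of_mem_sphere s

theorem inner_self_S2 (s : S2) : inner ℝ (s : E3) (s : E3) = 1 := by
  rw [real_inner_self_eq_norm_sq, norm_coe_S2, one_pow]

theorem coe_S2_ne_zero (s : S2) : (s : E3) ≠ 0 := by
  rw [← norm_ne_zero_iff, norm_coe_S2]; exact one_ne_zero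

theorem coe_retract {x : E3} (hx : x ≠ 0) : (retract x : E3) = ‖x‖⁻¹ • x := by
  simp [retract, hx]

@[simp] theorem retract_coe (s : S2) : retract (s : E3) = s := by
  apply Subtype.ext
  rw [coe_retract (coe_S2_ne_zero s), norm_coe_S2, inv_one, one_smul]

/-- The radial retraction is smooth away from the origin. -/
theorem contMDiffAt_retract {x : E3} (hx : x ≠ 0) :
    ContMDiffAt 𝓘(ℝ, E3) (𝓡 2) ∞ retract x := by
  let U : TopologicalSpace.Opens E3 := ⟨{y | y ≠ 0}, isOpen_ne⟩
  have hf : ContMDiff 𝓘(ℝ, E3) 𝓘(ℝ, E3) ∞ (fun y : U => ‖(y : E3)‖⁻¹ • (y : E3)) := by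
    intro y
    have hy : (y : E3) ≠ 0 := y.2
    have h1 : ContMDiffAt 𝓘(ℝ, E3) 𝓘(ℝ, E3) ∞ (fun z : E3 => ‖z‖⁻¹ • z) (y : E3) := by
      apply ContDiffAt.contMDiffAt
      exact ((contDiffAt_norm ℝ hy).inv (norm_ne_zero_iff.2 hy)).smul contDiffAt_id
    exact (contMDiffAt_subtype_iff (U := U)).2 h1
  have hm : ∀ y : U, ‖(y : E3)‖⁻¹ • (y : E3) ∈ Metric.sphere (0 : E3) 1 := by
    intro y
    have hy : (y : E3) ≠ 0 := y.2
    simp [norm_smul, hy]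
  have : Fact (Module.finrank ℝ E3 = 2 + 1) := ⟨finrank_euclideanSpace_fin⟩
  have h2 : ContMDiff 𝓘(ℝ, E3) (𝓡 2) ∞ (Set.codRestrict _ _ hm : U → S2) :=
    hf.codRestrict_sphere (n := 2) hm
  have h3 : (Set.codRestrict _ _ hm : U → S2) = fun y : U => retract (y : E3) := by
    funext y
    apply Subtype.ext
    rw [coe_retract y.2]
    rfl
  rw [h3] at h2
  exact (contMDiffAt_subtype_iff (U := U) (x := ⟨x, hx⟩)).1 (h2 ⟨x, hx⟩)

theorem continuousAt_retract {x : E3} (hx : x ≠ 0) : ContinuousAt retract x :=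
  (contMDiffAt_retract hx).continuousAt

theorem tendsto_retract (s : S2) : Filter.Tendsto retract (𝓝 (s : E3)) (𝓝 s) := by
  simpa [ContinuousAt] using continuousAt_retract (coe_S2_ne_zero s)

theorem contMDiff_coe_S2 : ContMDiff (𝓡 2) 𝓘(ℝ, E3) ∞ ((↑) : S2 → E3) :=
  have : Fact (Module.finrank ℝ E3 = 2 + 1) := ⟨finrank_euclideanSpace_fin⟩
  contMDiff_coe_sphere (n := 2)

/-- Smoothness on the sphere is smoothness of the extension that is constant along rays. -/
theorem contMDiffAt_iff_retract {f : S2 → ℝ} {s : S2} :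
    ContMDiffAt (𝓡 2) 𝓘(ℝ, ℝ) ∞ f s ↔ ContDiffAt ℝ ∞ (fun x : E3 => f (retract x)) (s : E3) := by
  constructor
  · intro hf
    have h1 : ContMDiffAt (𝓡 2) 𝓘(ℝ, ℝ) ∞ f (retract (s : E3)) := by simpa using hf
    exact (h1.comp (s : E3) (contMDiffAt_retract (coe_S2_ne_zero s))).contDiffAt
  · intro hf
    have h1 := hf.contMDiffAt.comp s (contMDiff_coe_S2 s)
    have h2 : (fun x : E3 => f (retract x)) ∘ ((↑) : S2 → E3) = f := by
      funext r; simp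
    rwa [h2] at h1

theorem contDiffAt_comp_retract {f : S2 → ℝ} (hf : ContMDiff (𝓡 2) 𝓘(ℝ, ℝ) ∞ f) (s : S2) :
    ContDiffAt ℝ ∞ (fun x : E3 => f (retract x)) (s : E3) :=
  contMDiffAt_iff_retract.1 (hf s)

theorem contDiffAt_coe_retract {x : E3} (hx : x ≠ 0) :
    ContDiffAt ℝ ∞ (fun x : E3 => (retract x : E3)) x := by
  have h := (contMDiff_coe_S2 (retract x)).comp x (contMDiffAt_retract hx)
  exact h.contDiffAt

/-- The orthogonal projection of `ℝ³` onto the tangent plane at `s`. -/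
def tangentProj (s : S2) : E3 →L[ℝ] E3 :=
  ContinuousLinearMap.id ℝ E3 - (innerSL ℝ (s : E3)).smulRight (s : E3)

theorem tangentProj_apply (s : S2) (v : E3) :
    tangentProj s v = v - inner ℝ (s : E3) v • (s : E3) := by
  simp [tangentProj]

theorem tangentProj_of_isTangent {s : S2} {v : E3} (hv : IsTangent s v) :
    tangentProj s v = v := by
  rw [tangentProj_apply, show inner ℝ (s : E3) v = 0 from hv, zero_smul, sub_zero]

/-- At a point of the sphere the differential of the radial retraction is the orthogonal
projection onto the tangent plane. -/
theorem hasFDerivAt_coe_retract (s : S2) :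
    HasFDerivAt (fun x : E3 => (retract x : E3)) (tangentProj s) (s : E3) := by
  have hs := coe_S2_ne_zero s
  have h0 : HasFDerivAt (fun x : E3 => ‖x‖ ^ 2) (2 • innerSL ℝ (s : E3)) (s : E3) :=
    (hasStrictFDerivAt_norm_sq (s : E3)).hasFDerivAt
  have h1 : HasFDerivAt (fun x : E3 => (‖x‖ ^ 2) ^ (-(1 / 2) : ℝ))
      (-innerSL ℝ (s : E3)) (s : E3) := by
    have := h0.rpow_const (p := (-(1 / 2) : ℝ)) (Or.inl (by simp))
    refine this.congr_fderiv ?_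
    rw [norm_coe_S2, one_pow, Real.one_rpow]
    ext1 v
    simp
  have h2 := h1.smul (hasFDerivAt_id (𝕜 := ℝ) (s : E3))
  refine (h2.congr_fderiv ?_).congr_of_eventuallyEq ?_
  · ext1 v
    simp [tangentProj_apply, sub_eq_add_neg]
  · filter_upwards [isOpen_ne.mem_nhds hs] with x hx
    have hx' : 0 < ‖x‖ := norm_pos_iff.2 hx
    rw [coe_retract hx]
    simp only [Pi.smul_apply', id]
    rw [← Real.rpow_natCast, ← Real.rpow_mul hx'.le]
    norm_num
    rw [Real.rpow_neg_one]

/-! ### The symplectic form -/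

theorem inner_E3 (u v : E3) : inner ℝ u v = u 0 * v 0 + u 1 * v 1 + u 2 * v 2 := by
  simp [PiLp.inner_apply, Fin.sum_univ_three, mul_comm]

theorem cross_E3 (u v : E3) :
    cross u v = !₂[u 1 * v 2 - u 2 * v 1, u 2 * v 0 - u 0 * v 2, u 0 * v 1 - u 1 * v 0] := by
  simp [cross, cross_apply]

theorem inner_cross_E3 (w u v : E3) : inner ℝ w (cross u v) =
    w 0 * (u 1 * v 2 - u 2 * v 1) + w 1 * (u 2 * v 0 - u 0 * v 2)
      + w 2 * (u 0 * v 1 - u 1 * v 0) := by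
  rw [inner_E3, cross_E3]; simp

theorem omega_apply (s : S2) (u v : E3) : omega s u v =
    (s : E3) 0 * (u 1 * v 2 - u 2 * v 1) + (s : E3) 1 * (u 2 * v 0 - u 0 * v 2)
      + (s : E3) 2 * (u 0 * v 1 - u 1 * v 0) :=
  inner_cross_E3 _ _ _

/-- Cramer's rule in `ℝ³`. -/
theorem cramer_E3 (s u v w : E3) :
    inner ℝ s (cross v w) • u - inner ℝ s (cross u w) • v + inner ℝ s (cross u v) • w
      = inner ℝ u (cross v w) • s := by
  simp only [inner_cross_E3]
  ext i
  fin_cases i <;> simp <;> ring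

/-- Tangent vectors at `s` lie in a plane, so three of them are linearly dependent. -/
theorem inner_cross_eq_zero_of_isTangent {s : S2} {u v w : E3} (hu : IsTangent s u)
    (hv : IsTangent s v) (hw : IsTangent s w) : inner ℝ u (cross v w) = 0 := by
  have h := congrArg (fun x => inner ℝ (s : E3) x) (cramer_E3 s u v w)
  simp only [inner_add_right, inner_sub_right, inner_smul_right, inner_self_S2] at h
  rw [show inner ℝ (s : E3) u = 0 from hu, show inner ℝ (s : E3) v = 0 from hv,
    show inner ℝ (s : E3) w = 0 from hw] at h
  linarith

theorem omega_skew (s : S2) (u v : E3) : omega s u v = -omega s v u := by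
  simp only [omega_apply]; ring

/-- The rotation intertwines the area form and the inner product. -/
theorem omega_rot (s : S2) (u v : E3) (hv : IsTangent s v) :
    omega s (rot s u) v = inner ℝ u v := by
  simpa [metric, areaForm] using (metric_eq_areaForm (fun _ => 1) s u v hv).symm

theorem isTangent_rot (s : S2) (u : E3) : IsTangent s (rot s u) := by
  rw [IsTangent, rot, inner_cross_E3]; ring

theorem omega_zero_right (s : S2) (u : E3) : omega s u 0 = 0 := by
  simp [omega_apply]

theorem omega_add_left (s : S2) (u u' v : E3) :
    omega s (u + u') v = omega s u v + omega s u' v := by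
  simp only [omega_apply, PiLp.add_apply]; ring

theorem omega_smul_left (s : S2) (a : ℝ) (u v : E3) :
    omega s (a • u) v = a * omega s u v := by
  simp only [omega_apply, PiLp.smul_apply, smul_eq_mul]; ring

/-- The area form is nondegenerate on the tangent plane. -/
theorem eq_zero_of_omega_eq_zero {s : S2} {u : E3} (hu : IsTangent s u)
    (h : ∀ v, IsTangent s v → omega s u v = 0) : u = 0 := by
  have h1 := h (rot s u) (isTangent_rot s u)
  rw [omega_skew, omega_rot s u u hu, neg_eq_zero, inner_self_eq_zero] at h1
  exact h1

theorem contDiffAt_comp_retractAll {N : ℕ} {f : S2 → ℝ} (hf : ContMDiff (𝓡 2) 𝓘(ℝ, ℝ) ∞ f)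
    (σ : Config N) (j : Fin N) :
    ContDiffAt ℝ ∞ (fun x : Fin N → E3 => f (retractAll x j)) (incl σ) :=
  ContDiffAt.comp (g := fun x : E3 => f (retract x)) (f := fun x : Fin N → E3 => x j) (incl σ)
    (contDiffAt_comp_retract hf (σ j)) (contDiff_apply ℝ E3 j).contDiffAt

theorem contDiffAt_coe_retractAll {N : ℕ} (σ : Config N) (j : Fin N) :
    ContDiffAt ℝ ∞ (fun x : Fin N → E3 => (retractAll x j : E3)) (incl σ) :=
  ContDiffAt.comp (g := fun x : E3 => (retract x : E3)) (f := fun x : Fin N → E3 => x j) (incl σ)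
    (contDiffAt_coe_retract (coe_S2_ne_zero (σ j))) (contDiff_apply ℝ E3 j).contDiffAt

/-- The differential of a function that depends on one point only. -/
theorem hasFDerivAt_comp_apply {N : ℕ} {f : S2 → ℝ} (σ : Config N) (j : Fin N)
    (hf : DifferentiableAt ℝ (fun x : E3 => f (retract x)) (σ j : E3)) :
    HasFDerivAt (fun x : Fin N → E3 => f (retractAll x j))
      ((fderiv ℝ (fun x : E3 => f (retract x)) (σ j : E3)).comp
        (ContinuousLinearMap.proj (R := ℝ) j)) (incl σ) := by
  have h1 : HasFDerivAt (fun x : Fin N → E3 => x j)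
      (ContinuousLinearMap.proj (R := ℝ) (φ := fun _ : Fin N => E3) j) (incl σ) :=
    hasFDerivAt_apply j _
  exact HasFDerivAt.comp (g := fun x : E3 => f (retract x)) (incl σ)
    (by simpa [incl] using hf.hasFDerivAt) h1

theorem contDiffAt_sq_mul_omega {h : S2 → ℝ} (hsmooth : ContMDiff (𝓡 2) 𝓘(ℝ, ℝ) ∞ h)
    (s : S2) (u v : E3) :
    ContDiffAt ℝ ∞ (fun x : E3 => h (retract x) ^ 2 * omega (retract x) u v) (s : E3) :=
  ((contDiffAt_comp_retract hsmooth s).pow 2).mul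
    ((contDiffAt_coe_retract (coe_S2_ne_zero s)).inner ℝ contDiffAt_const)

theorem fderiv_sq_mul_omega {h : S2 → ℝ} (hsmooth : ContMDiff (𝓡 2) 𝓘(ℝ, ℝ) ∞ h)
    (s : S2) (u v : E3) {w : E3} (hw : IsTangent s w) :
    fderiv ℝ (fun x : E3 => h (retract x) ^ 2 * omega (retract x) u v) (s : E3) w
      = fderiv ℝ (fun x : E3 => h (retract x) ^ 2) (s : E3) w * omega s u v
        + h s ^ 2 * inner ℝ w (cross u v) := by
  have h1 : HasFDerivAt (fun x : E3 => h (retract x) ^ 2) _ (s : E3) :=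
    (((contDiffAt_comp_retract hsmooth s).pow 2).differentiableAt (by simp)).hasFDerivAt
  have h2 := (hasFDerivAt_coe_retract s).inner ℝ (hasFDerivAt_const (cross u v) (s : E3))
  have h3 := h1.mul h2
  have h4 : fderiv ℝ (fun x : E3 => h (retract x) ^ 2 * omega (retract x) u v) (s : E3) = _ :=
    h3.fderiv
  rw [h4]
  simp [tangentProj_of_isTangent hw, omega]
  ring

/-- The closedness of `h² ω` in the form of the Cartan formula for constant vectors: on a surface,
any three tangent vectors are dependent. -/
theorem cartan_sq_mul_omega {h : S2 → ℝ} (hsmooth : ContMDiff (𝓡 2) 𝓘(ℝ, ℝ) ∞ h)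
    (s : S2) {u v w : E3} (hu : IsTangent s u) (hv : IsTangent s v) (hw : IsTangent s w) :
    fderiv ℝ (fun x : E3 => h (retract x) ^ 2 * omega (retract x) v w) (s : E3) u
      - fderiv ℝ (fun x : E3 => h (retract x) ^ 2 * omega (retract x) u w) (s : E3) v
      + fderiv ℝ (fun x : E3 => h (retract x) ^ 2 * omega (retract x) u v) (s : E3) w = 0 := by
  rw [fderiv_sq_mul_omega hsmooth s v w hu, fderiv_sq_mul_omega hsmooth s u w hv,
    fderiv_sq_mul_omega hsmooth s u v hw, inner_cross_eq_zero_of_isTangent hu hv hw,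
    inner_cross_eq_zero_of_isTangent hv hu hw, inner_cross_eq_zero_of_isTangent hw hu hv]
  have h1 := congrArg (fderiv ℝ (fun x : E3 => h (retract x) ^ 2) (s : E3)) (cramer_E3 s u v w)
  rw [inner_cross_eq_zero_of_isTangent hu hv hw] at h1
  simp only [map_add, map_sub, map_smul, zero_smul, map_zero, smul_eq_mul] at h1
  simp only [omega]
  linarith

theorem differential_vortexForm {N : ℕ} {h : S2 → ℝ} (hsmooth : ContMDiff (𝓡 2) 𝓘(ℝ, ℝ) ∞ h)
    (κ : Fin N → ℝ) (σ : Config N) (ξ η ζ : Fin N → E3) :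
    differential (fun τ => vortexForm h κ τ η ζ) σ ξ =
      ∑ j, κ j * fderiv ℝ (fun x : E3 => h (retract x) ^ 2 * omega (retract x) (η j) (ζ j))
        (σ j : E3) (ξ j) := by
  have h1 : HasFDerivAt (fun x : Fin N → E3 => vortexForm h κ (retractAll x) η ζ) _ (incl σ) :=
    HasFDerivAt.fun_sum (u := Finset.univ) fun j _ =>
      (hasFDerivAt_comp_apply (f := fun s => h s ^ 2 * omega s (η j) (ζ j)) σ j
        ((contDiffAt_sq_mul_omega hsmooth (σ j) (η j) (ζ j)).differentiableAt
          (by simp))).const_mul (κ j)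
  rw [differential, h1.fderiv]
  simp

theorem vortexForm_single {N : ℕ} (h : S2 → ℝ) (κ : Fin N → ℝ) (σ : Config N)
    (ξ : Fin N → E3) (j : Fin N) (v : E3) :
    vortexForm h κ σ ξ (Pi.single j v) = κ j * (h (σ j) ^ 2 * omega (σ j) (ξ j) v) := by
  rw [vortexForm, Finset.sum_eq_single j]
  · simp
  · intro i _ hij
    simp [Pi.single_eq_of_ne hij, omega_zero_right]
  · simp

theorem isTangentVector_single {N : ℕ} {σ : Config N} {j : Fin N} {v : E3}
    (hv : IsTangent (σ j) v) : IsTangentVector σ (Pi.single j v) := by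
  intro i
  rcases eq_or_ne i j with rfl | hij
  · simpa using hv
  · simp [Pi.single_eq_of_ne hij, IsTangent]

theorem isSymplecticForm_vortexForm {N : ℕ} {κ : Fin N → ℝ} (hκ : ∀ j, κ j ≠ 0)
    {h : S2 → ℝ} (hsmooth : ContMDiff (𝓡 2) 𝓘(ℝ, ℝ) ∞ h) (hpos : ∀ s, 0 < h s) :
    IsSymplecticForm (vortexForm h κ) where
  add_left σ ξ ξ' η := by
    simp only [vortexForm, Pi.add_apply, omega_add_left, mul_add, Finset.sum_add_distrib]
  smul_left σ a ξ η := by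
    simp only [vortexForm, Pi.smul_apply, omega_smul_left, Finset.mul_sum]
    exact Finset.sum_congr rfl fun j _ => by ring
  skew σ ξ η := by
    simp only [vortexForm, ← Finset.sum_neg_distrib]
    exact Finset.sum_congr rfl fun j _ => by rw [omega_skew]; ring
  smooth σ ξ η := by
    refine ContDiffAt.sum fun j _ => contDiffAt_const.mul
      (((contDiffAt_comp_retractAll hsmooth σ j).pow 2).mul ?_)
    exact (contDiffAt_coe_retractAll σ j).inner ℝ contDiffAt_const
  closed σ ξ η ζ hξ hη hζ := by
    simp only [differential_vortexForm hsmooth, ← Finset.sum_sub_distrib, ← Finset.sum_add_distrib]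
    refine Finset.sum_eq_zero fun j _ => ?_
    rw [← mul_sub, ← mul_add, cartan_sq_mul_omega hsmooth (σ j) (hξ j) (hη j) (hζ j), mul_zero]
  nondegenerate σ ξ hξ hΩ := by
    funext j
    refine eq_zero_of_omega_eq_zero (hξ j) fun v hv => ?_
    have h1 := hΩ (Pi.single j v) (isTangentVector_single hv)
    rw [vortexForm_single] at h1
    simpa [hκ j, (hpos (σ j)).ne'] using h1

/-! ### The Laplacian of the round sphere -/

/-- The function `f` on the sphere is smooth at `s`, expressed by its extension that is constant
along rays. -/
def SmoothAt (f : S2 → ℝ) (s : S2) : Prop :=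
  ContDiffAt ℝ ∞ (fun x : E3 => f (retract x)) (s : E3)

theorem SmoothAt.add {f g : S2 → ℝ} {s : S2} (hf : SmoothAt f s) (hg : SmoothAt g s) :
    SmoothAt (fun r => f r + g r) s :=
  ContDiffAt.add hf hg

theorem SmoothAt.sub {f g : S2 → ℝ} {s : S2} (hf : SmoothAt f s) (hg : SmoothAt g s) :
    SmoothAt (fun r => f r - g r) s :=
  ContDiffAt.sub hf hg

theorem SmoothAt.const_mul {f : S2 → ℝ} {s : S2} (c : ℝ) (hf : SmoothAt f s) :
    SmoothAt (fun r => c * f r) s :=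
  ContDiffAt.mul contDiffAt_const hf

theorem SmoothAt.sum {ι : Type*} {f : ι → S2 → ℝ} {s : S2} {t : Finset ι}
    (hf : ∀ i ∈ t, SmoothAt (f i) s) : SmoothAt (fun r => ∑ i ∈ t, f i r) s :=
  ContDiffAt.sum hf

theorem smoothAt_const (c : ℝ) (s : S2) : SmoothAt (fun _ => c) s := contDiffAt_const

theorem smoothAt_iff_contMDiffAt {f : S2 → ℝ} {s : S2} :
    SmoothAt f s ↔ ContMDiffAt (𝓡 2) 𝓘(ℝ, ℝ) ∞ f s :=
  contMDiffAt_iff_retract.symm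

theorem SmoothAt.continuousAt {f : S2 → ℝ} {s : S2} (hf : SmoothAt f s) : ContinuousAt f s :=
  (smoothAt_iff_contMDiffAt.1 hf).continuousAt

theorem SmoothAt.differentiableAt {f : S2 → ℝ} {s : S2} (hf : SmoothAt f s) :
    DifferentiableAt ℝ (fun x : E3 => f (retract x)) (s : E3) :=
  ContDiffAt.differentiableAt hf (by simp)

theorem tendsto_coe_S2 (s : S2) : Filter.Tendsto ((↑) : S2 → E3) (𝓝 s) (𝓝 (s : E3)) :=
  continuous_subtype_val.continuousAt

theorem SmoothAt.eventually_differentiableAt {f : S2 → ℝ} {s : S2} (hf : SmoothAt f s) :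
    ∀ᶠ r : S2 in 𝓝 s, DifferentiableAt ℝ (fun x : E3 => f (retract x)) (r : E3) := by
  have h1 : ContDiffAt ℝ 1 (fun x : E3 => f (retract x)) (s : E3) := ContDiffAt.of_le hf (by simp)
  filter_upwards [(tendsto_coe_S2 s).eventually (h1.eventually (by simp))] with r hr
  exact hr.differentiableAt (by simp)

theorem inner_sphereGrad (f : S2 → ℝ) (s : S2) (v : E3) :
    inner ℝ (sphereGrad f s) v = fderiv ℝ (fun x : E3 => f (retract x)) (s : E3) v :=
  inner_gradient_left

theorem sphereGrad_congr {f g : S2 → ℝ} {s : S2} (hfg : f =ᶠ[𝓝 s] g) :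
    sphereGrad f s = sphereGrad g s :=
  Filter.EventuallyEq.gradient_eq ((tendsto_retract s).eventually hfg)

theorem sphereGrad_eq {f : S2 → ℝ} {s : S2} {L : E3 →L[ℝ] ℝ} {w : E3}
    (hf : HasFDerivAt (fun x : E3 => f (retract x)) L (s : E3)) (hL : ∀ v, L v = inner ℝ w v) :
    sphereGrad f s = w := by
  refine ext_inner_right ℝ fun v => ?_
  rw [inner_sphereGrad, hf.fderiv, hL]

theorem sphereGrad_add {f g : S2 → ℝ} {s : S2}
    (hf : DifferentiableAt ℝ (fun x : E3 => f (retract x)) (s : E3))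
    (hg : DifferentiableAt ℝ (fun x : E3 => g (retract x)) (s : E3)) :
    sphereGrad (fun r => f r + g r) s = sphereGrad f s + sphereGrad g s :=
  sphereGrad_eq (hf.hasFDerivAt.add hg.hasFDerivAt) fun v => by
    simp [inner_add_left, inner_sphereGrad]

theorem sphereGrad_const_mul {f : S2 → ℝ} {s : S2} (c : ℝ)
    (hf : DifferentiableAt ℝ (fun x : E3 => f (retract x)) (s : E3)) :
    sphereGrad (fun r => c * f r) s = c • sphereGrad f s :=
  sphereGrad_eq (hf.hasFDerivAt.const_mul c) fun v => by
    simp [inner_smul_left, inner_sphereGrad]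

theorem sphereGrad_const (c : ℝ) (s : S2) : sphereGrad (fun _ => c) s = 0 :=
  sphereGrad_eq (hasFDerivAt_const c (s : E3)) fun v => by simp

/-- The Laplace-Beltrami operator of the round metric. -/
def sphereLaplacian (f : S2 → ℝ) (s : S2) : ℝ := sphereDiv (sphereGrad f) s

/-- Conformal invariance of the Laplacian in dimension two. -/
theorem laplaceBeltrami_eq {h : S2 → ℝ} (hpos : ∀ s, 0 < h s) (f : S2 → ℝ) (s : S2) :
    laplaceBeltrami h f s = (h s ^ 2)⁻¹ * sphereLaplacian f s := by
  have h1 : (fun r => h r ^ 2 • grad h f r) = sphereGrad f := by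
    funext r
    rw [grad, smul_smul, mul_inv_cancel₀ (pow_pos (hpos r) 2).ne', one_smul]
  rw [laplaceBeltrami, divergence, h1, sphereLaplacian]

theorem sphereDiv_congr {X Y : S2 → E3} {s : S2} (hXY : X =ᶠ[𝓝 s] Y) :
    sphereDiv X s = sphereDiv Y s := by
  have h1 : (fun x : E3 => X (retract x)) =ᶠ[𝓝 (s : E3)] fun x : E3 => Y (retract x) :=
    (tendsto_retract s).eventually hXY
  rw [sphereDiv, sphereDiv, h1.fderiv_eq]

theorem SmoothAt.hasFDerivAt_gradient {f : S2 → ℝ} {s : S2} (hf : SmoothAt f s) :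
    HasFDerivAt (gradient fun x : E3 => f (retract x))
      (fderiv ℝ (gradient fun x : E3 => f (retract x)) (s : E3)) (s : E3) := by
  have h1 : ContDiffAt ℝ 1 (fderiv ℝ (fun x : E3 => f (retract x))) (s : E3) :=
    ContDiffAt.fderiv_right (m := 1) (n := ∞) hf
      (by rw [one_add_one_eq_two]; exact WithTop.coe_le_coe.2 le_top)
  have h2 : ContDiffAt ℝ 1 (gradient fun x : E3 => f (retract x)) (s : E3) :=
    (InnerProductSpace.toDual ℝ E3).symm.contDiff.contDiffAt.comp (s : E3) h1
  exact (h2.differentiableAt (by simp)).hasFDerivAt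

theorem SmoothAt.hasFDerivAt_sphereGrad {f : S2 → ℝ} {s : S2} (hf : SmoothAt f s) :
    HasFDerivAt (fun x : E3 => sphereGrad f (retract x))
      ((fderiv ℝ (gradient fun x : E3 => f (retract x)) (s : E3)).comp (tangentProj s))
      (s : E3) := by
  have h1 := hf.hasFDerivAt_gradient
  exact HasFDerivAt.comp (g := gradient fun x : E3 => f (retract x)) (s : E3)
    (by simpa using h1) (hasFDerivAt_coe_retract s)

theorem sphereLaplacian_add {f g : S2 → ℝ} {s : S2} (hf : SmoothAt f s) (hg : SmoothAt g s) :
    sphereLaplacian (fun r => f r + g r) s = sphereLaplacian f s + sphereLaplacian g s := by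
  have h1 : sphereGrad (fun r => f r + g r) =ᶠ[𝓝 s] fun r => sphereGrad f r + sphereGrad g r := by
    filter_upwards [hf.eventually_differentiableAt, hg.eventually_differentiableAt] with r h1 h2
    exact sphereGrad_add h1 h2
  have h2 := hf.hasFDerivAt_sphereGrad.fun_add hg.hasFDerivAt_sphereGrad
  rw [sphereLaplacian, sphereDiv_congr h1, sphereDiv, h2.fderiv, sphereLaplacian,
    sphereLaplacian, sphereDiv, sphereDiv, hf.hasFDerivAt_sphereGrad.fderiv,
    hg.hasFDerivAt_sphereGrad.fderiv, ContinuousLinearMap.toLinearMap_add, map_add]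

theorem sphereLaplacian_const_mul {f : S2 → ℝ} {s : S2} (c : ℝ) (hf : SmoothAt f s) :
    sphereLaplacian (fun r => c * f r) s = c * sphereLaplacian f s := by
  have h1 : sphereGrad (fun r => c * f r) =ᶠ[𝓝 s] fun r => c • sphereGrad f r := by
    filter_upwards [hf.eventually_differentiableAt] with r h1
    exact sphereGrad_const_mul c h1
  have h2 := hf.hasFDerivAt_sphereGrad.fun_const_smul c
  rw [sphereLaplacian, sphereDiv_congr h1, sphereDiv, h2.fderiv, sphereLaplacian,
    sphereDiv, hf.hasFDerivAt_sphereGrad.fderiv, ContinuousLinearMap.toLinearMap_smul, map_smul,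
    smul_eq_mul]

theorem sphereLaplacian_sub {f g : S2 → ℝ} {s : S2} (hf : SmoothAt f s) (hg : SmoothAt g s) :
    sphereLaplacian (fun r => f r - g r) s = sphereLaplacian f s - sphereLaplacian g s := by
  have h1 := sphereLaplacian_add hf (hg.const_mul (-1))
  rw [sphereLaplacian_const_mul (-1) hg] at h1
  simpa [sub_eq_add_neg] using h1

theorem sphereLaplacian_const (c : ℝ) (s : S2) : sphereLaplacian (fun _ => c) s = 0 := by
  simp [sphereLaplacian, sphereDiv, sphereGrad_const]

theorem sphereLaplacian_sum {ι : Type*} {f : ι → S2 → ℝ} {s : S2} {t : Finset ι}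
    (hf : ∀ i ∈ t, SmoothAt (f i) s) :
    sphereLaplacian (fun r => ∑ i ∈ t, f i r) s = ∑ i ∈ t, sphereLaplacian (f i) s := by
  classical
  induction t using Finset.induction_on with
  | empty => simp [sphereLaplacian_const]
  | insert a t ha ih =>
    simp only [Finset.sum_insert ha]
    rw [sphereLaplacian_add (hf a (Finset.mem_insert_self a t))
      (SmoothAt.sum fun i hi => hf i (Finset.mem_insert_of_mem hi)),
      ih fun i hi => hf i (Finset.mem_insert_of_mem hi)]

/-- The second derivative along a line of a function extended along rays. -/
theorem SmoothAt.deriv_deriv_line {f : S2 → ℝ} {s : S2} (hf : SmoothAt f s) (v : E3) :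
    deriv (deriv fun t : ℝ => f (retract ((s : E3) + t • v))) 0
      = inner ℝ (fderiv ℝ (gradient fun x : E3 => f (retract x)) (s : E3) v) v := by
  set F : E3 → ℝ := fun x => f (retract x) with hF
  have hl : ∀ t : ℝ, HasDerivAt (fun t : ℝ => (s : E3) + t • v) v t := fun t => by
    simpa using ((hasDerivAt_id t).smul_const v).const_add (s : E3)
  have h0 : Filter.Tendsto (fun t : ℝ => (s : E3) + t • v) (𝓝 0) (𝓝 (s : E3)) := by
    simpa using (hl 0).continuousAt.tendsto
  have h1 : ContDiffAt ℝ 1 F (s : E3) := ContDiffAt.of_le hf (by simp)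
  have h2 : deriv (fun t : ℝ => F ((s : E3) + t • v))
      =ᶠ[𝓝 0] fun t => inner ℝ (gradient F ((s : E3) + t • v)) v := by
    filter_upwards [h0.eventually (h1.eventually (by simp))] with t ht
    have h3 := (ht.differentiableAt (by simp)).hasFDerivAt.comp_hasDerivAt t (hl t)
    rw [inner_gradient_left]
    exact h3.deriv
  have h4 : HasFDerivAt (gradient F) (fderiv ℝ (gradient F) (s : E3)) ((s : E3) + (0 : ℝ) • v) := by
    simpa using hf.hasFDerivAt_gradient
  have h5 := (h4.comp_hasDerivAt 0 (hl 0)).inner ℝ (hasDerivAt_const 0 v)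
  have h6 : deriv (fun t : ℝ => inner ℝ (gradient F ((s : E3) + t • v)) v) 0 = _ := h5.deriv
  rw [h2.deriv_eq, h6]
  simp

/-- A positive second derivative would make `t` a local minimum too, and `g` constant near `t`. -/
theorem deriv_deriv_nonpos_of_isLocalMax {g : ℝ → ℝ} {t : ℝ} (hg : IsLocalMax g t)
    (hc : ContinuousAt g t) : deriv (deriv g) t ≤ 0 := by
  by_contra! hpos
  have hmin := isLocalMin_of_deriv_deriv_pos hpos hg.deriv_eq_zero hc
  have heq : g =ᶠ[𝓝 t] fun _ => g t := by
    filter_upwards [hg, hmin] with x h1 h2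
    exact le_antisymm h1 h2
  rw [heq.deriv.deriv_eq] at hpos
  simp at hpos

/-- The Laplacian on the sphere is the Euclidean Laplacian of the extension along rays, written
here as the trace of its Hessian. -/
theorem SmoothAt.sphereLaplacian_eq_trace {f : S2 → ℝ} {s : S2} (hf : SmoothAt f s) :
    sphereLaplacian f s = LinearMap.trace ℝ E3
      (fderiv ℝ (gradient fun x : E3 => f (retract x)) (s : E3)).toLinearMap := by
  set A := fderiv ℝ (gradient fun x : E3 => f (retract x)) (s : E3) with hA
  -- the extension is constant along the ray through `s`
  have h0 : inner ℝ (A (s : E3)) (s : E3) = 0 := by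
    rw [hA, ← hf.deriv_deriv_line]
    have h1 : (fun t : ℝ => f (retract ((s : E3) + t • (s : E3)))) =ᶠ[𝓝 0] fun _ => f s := by
      filter_upwards [lt_mem_nhds (show (-1 : ℝ) < 0 by norm_num)] with t ht
      have ht' : 0 < 1 + t := by linarith
      have h2 : retract ((s : E3) + t • (s : E3)) = s := by
        have h3 : (s : E3) + t • (s : E3) = (1 + t) • (s : E3) := by rw [add_smul, one_smul]
        have h4 : (1 + t) • (s : E3) ≠ 0 := smul_ne_zero ht'.ne' (coe_S2_ne_zero s)
        apply Subtype.ext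
        rw [h3, coe_retract h4, norm_smul, norm_coe_S2, mul_one, smul_smul, Real.norm_eq_abs,
          abs_of_pos ht', inv_mul_cancel₀ ht'.ne', one_smul]
      rw [h2]
    rw [h1.deriv.deriv_eq]
    simp
  have h1 : (A.comp (tangentProj s)).toLinearMap
      = A.toLinearMap - (innerSL ℝ (s : E3)).toLinearMap.smulRight (A (s : E3)) := by
    ext v
    simp [tangentProj_apply]
  rw [sphereLaplacian, sphereDiv, hf.hasFDerivAt_sphereGrad.fderiv, ← hA, h1, map_sub,
    LinearMap.trace_smulRight]
  change _ - inner ℝ (s : E3) (A (s : E3)) = _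
  rw [real_inner_comm, h0, sub_zero]

theorem sphereLaplacian_nonpos_of_isLocalMax {f : S2 → ℝ} {s : S2} (hf : SmoothAt f s)
    (hmax : IsLocalMax f s) : sphereLaplacian f s ≤ 0 := by
  rw [hf.sphereLaplacian_eq_trace,
    LinearMap.trace_eq_sum_inner _ (EuclideanSpace.basisFun (Fin 3) ℝ)]
  refine Finset.sum_nonpos fun i _ => ?_
  set v := EuclideanSpace.basisFun (Fin 3) ℝ i
  rw [real_inner_comm]
  change inner ℝ (fderiv ℝ (gradient fun x : E3 => f (retract x)) (s : E3) v) v ≤ 0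
  rw [← hf.deriv_deriv_line]
  have h0 : Filter.Tendsto (fun t : ℝ => (s : E3) + t • v) (𝓝 0) (𝓝 (s : E3)) := by
    have : Continuous fun t : ℝ => (s : E3) + t • v := by fun_prop
    simpa using this.tendsto 0
  have h1 : Filter.Tendsto (fun t : ℝ => retract ((s : E3) + t • v)) (𝓝 0) (𝓝 s) :=
    (tendsto_retract s).comp h0
  apply deriv_deriv_nonpos_of_isLocalMax
  · filter_upwards [h1.eventually hmax] with t ht
    simpa using ht
  · have h2 := hf.continuousAt.tendsto.comp h1
    simpa [ContinuousAt, Function.comp_def] using h2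

/-! ### The logarithm of the Euclidean distance -/

/-- The logarithm of the Euclidean distance to `p`. -/
def logDist (p s : S2) : ℝ := Real.log ‖(s : E3) - (p : E3)‖

theorem logDist_comm (p s : S2) : logDist p s = logDist s p := by
  rw [logDist, logDist, norm_sub_rev]

theorem norm_sub_sq_S2 (s p : S2) :
    ‖(s : E3) - (p : E3)‖ ^ 2 = 2 - 2 * inner ℝ (s : E3) (p : E3) := by
  rw [norm_sub_sq_real, norm_coe_S2, norm_coe_S2]; ring

theorem norm_sub_pos_S2 {s p : S2} (hsp : s ≠ p) : 0 < ‖(s : E3) - (p : E3)‖ :=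
  norm_pos_iff.2 (sub_ne_zero.2 fun h => hsp (Subtype.ext h))

theorem inner_lt_one_S2 {s p : S2} (hsp : s ≠ p) : inner ℝ (s : E3) (p : E3) < 1 := by
  have h1 := norm_sub_sq_S2 s p
  have h2 := pow_pos (norm_sub_pos_S2 hsp) 2
  linarith

theorem logDist_eq (p s : S2) :
    logDist p s = 1 / 2 * Real.log (2 - 2 * inner ℝ (s : E3) (p : E3)) := by
  rw [← norm_sub_sq_S2, Real.log_pow, logDist]; push_cast; ring

theorem smoothAt_logDist {p s : S2} (hsp : s ≠ p) : SmoothAt (logDist p) s := by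
  have h1 : ContDiffAt ℝ ∞ (fun x : E3 => 1 / 2 *
      Real.log (2 - 2 * inner ℝ (retract x : E3) (p : E3))) (s : E3) := by
    refine contDiffAt_const.mul (ContDiffAt.log (contDiffAt_const.sub (contDiffAt_const.mul
      ((contDiffAt_coe_retract (coe_S2_ne_zero s)).inner ℝ contDiffAt_const))) ?_)
    have := inner_lt_one_S2 hsp
    rw [retract_coe]
    linarith
  exact h1.congr_of_eventuallyEq (Filter.Eventually.of_forall fun x => logDist_eq p (retract x))

theorem hasFDerivAt_inner_retract (p s : S2) :
    HasFDerivAt (fun x : E3 => inner ℝ (retract x : E3) (p : E3))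
      (innerSL ℝ ((p : E3) - inner ℝ (s : E3) (p : E3) • (s : E3))) (s : E3) := by
  refine ((hasFDerivAt_coe_retract s).inner ℝ
    (hasFDerivAt_const (p : E3) (s : E3))).congr_fderiv ?_
  ext1 v
  simp [tangentProj_apply, inner_sub_left, inner_smul_left, real_inner_comm]
  ring

theorem sphereGrad_logDist {p s : S2} (hsp : s ≠ p) :
    sphereGrad (logDist p) s = -(2 * (1 - inner ℝ (s : E3) (p : E3)))⁻¹ •
      ((p : E3) - inner ℝ (s : E3) (p : E3) • (s : E3)) := by
  have h1 := inner_lt_one_S2 hsp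
  have h2 : HasFDerivAt (fun x : E3 => 1 / 2 *
      Real.log (2 - 2 * inner ℝ (retract x : E3) (p : E3))) _ (s : E3) :=
    ((((hasFDerivAt_inner_retract p s).const_mul 2).const_sub 2).log
      (by rw [retract_coe]; linarith)).const_mul (1 / 2)
  refine sphereGrad_eq (L := _) (h2.congr_of_eventuallyEq
    (Filter.Eventually.of_forall fun x => logDist_eq p (retract x))) fun v => ?_
  simp only [retract_coe, inner_smul_left, smul_apply,
    neg_apply, innerSL_apply_apply, smul_eq_mul, conj_trivial]
  have h3 : 2 - 2 * inner ℝ (s : E3) (p : E3) ≠ 0 := by linarith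
  have h4 : 1 - inner ℝ (s : E3) (p : E3) ≠ 0 := by linarith
  field_simp

/-- The logarithm of the distance to a point has constant Laplacian on the round sphere. -/
theorem sphereLaplacian_logDist {p s : S2} (hsp : s ≠ p) :
    sphereLaplacian (logDist p) s = -(1 / 2) := by
  have h1 := inner_lt_one_S2 hsp
  have h4 : 1 - inner ℝ (s : E3) (p : E3) ≠ 0 := by linarith
  have h2 : sphereGrad (logDist p) =ᶠ[𝓝 s] fun r =>
      (2 * (inner ℝ (r : E3) (p : E3) - 1))⁻¹ •
        ((p : E3) - inner ℝ (r : E3) (p : E3) • (r : E3)) := by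
    filter_upwards [isOpen_ne.mem_nhds hsp] with r hr
    rw [sphereGrad_logDist hr, ← inv_neg]
    congr 2
    ring
  have hz := hasFDerivAt_inner_retract p s
  have h5 : HasDerivAt (fun z : ℝ => (2 * (z - 1))⁻¹)
      (-(2 * (inner ℝ (s : E3) (p : E3) - 1) ^ 2)⁻¹)
      (inner ℝ (retract (s : E3) : E3) (p : E3)) := by
    rw [retract_coe]
    have h6 := (((hasDerivAt_id (inner ℝ (s : E3) (p : E3))).sub_const 1).const_mul 2).inv
      (mul_ne_zero two_ne_zero fun h => h4 (by simp at h; linarith))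
    have h7 : inner ℝ (s : E3) (p : E3) - 1 ≠ 0 := by intro h; exact h4 (by linarith)
    refine HasDerivAt.congr_deriv h6 ?_
    rw [id]
    field_simp
  have h6 := (h5.comp_hasFDerivAt (s : E3) hz).smul
    ((hz.smul (hasFDerivAt_coe_retract s)).const_sub (p : E3))
  have h7 : fderiv ℝ (fun x : E3 => (2 * (inner ℝ (retract x : E3) (p : E3) - 1))⁻¹ •
        ((p : E3) - inner ℝ (retract x : E3) (p : E3) • (retract x : E3))) (s : E3) = _ := h6.fderiv
  rw [sphereLaplacian, sphereDiv_congr h2, sphereDiv, h7]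
  have ht : LinearMap.trace ℝ E3 (tangentProj s).toLinearMap = 2 := by
    have h8 : (tangentProj s).toLinearMap
        = LinearMap.id - (innerSL ℝ (s : E3)).toLinearMap.smulRight (s : E3) := by
      ext v; simp [tangentProj_apply]
    rw [h8, map_sub, LinearMap.trace_smulRight, LinearMap.trace_id]
    simp
    norm_num
  set z : ℝ := inner ℝ (s : E3) (p : E3) with hzdef
  set w : E3 := (p : E3) - z • (s : E3) with hw
  have hws : inner ℝ w (s : E3) = 0 := by
    rw [hw, inner_sub_left, inner_smul_left, inner_self_S2, hzdef, real_inner_comm]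
    simp
  have hww : inner ℝ w w = 1 - z ^ 2 := by
    have h9 : inner ℝ w w = inner ℝ w (p : E3) - z * inner ℝ w (s : E3) := by
      conv_lhs => rw [hw, inner_sub_right, inner_smul_right, ← hw]
    rw [h9, hws, hw, inner_sub_left, inner_smul_left, inner_self_S2, ← hzdef]
    simp
    ring
  have h8 : (((2 * (z - 1))⁻¹ • -(z • tangentProj s + (innerSL ℝ w).smulRight (s : E3)) +
      (-(2 * (z - 1) ^ 2)⁻¹ • innerSL ℝ w).smulRight w : E3 →L[ℝ] E3)).toLinearMap
      = (2 * (z - 1))⁻¹ • -(z • (tangentProj s).toLinearMap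
        + (innerSL ℝ w).toLinearMap.smulRight (s : E3)) +
      (-(2 * (z - 1) ^ 2)⁻¹ • (innerSL ℝ w).toLinearMap).smulRight w := by
    ext v; simp
  have h9 : z - 1 ≠ 0 := fun h => h4 (by linarith)
  simp only [Pi.smul_apply', Function.comp_apply, retract_coe, ← hzdef, ← hw]
  rw [h8, map_add, map_smul, map_neg, map_add, map_smul, LinearMap.trace_smulRight,
    LinearMap.trace_smulRight, ht]
  change (2 * (z - 1))⁻¹ * -(z * 2 + inner ℝ w (s : E3))
    + -(2 * (z - 1) ^ 2)⁻¹ * inner ℝ w w = -(1 / 2)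
  rw [hws, hww]
  field_simp
  ring

/-! ### Bounded harmonic functions with punctures -/

theorem tendsto_norm_sub_S2 (p : S2) :
    Filter.Tendsto (fun s : S2 => ‖(s : E3) - (p : E3)‖) (𝓝[≠] p) (𝓝[>] 0) := by
  refine tendsto_nhdsWithin_iff.2 ⟨?_, ?_⟩
  · have h1 : Continuous fun s : S2 => ‖(s : E3) - (p : E3)‖ := by fun_prop
    simpa using (h1.tendsto p).mono_left nhdsWithin_le_nhds
  · filter_upwards [self_mem_nhdsWithin] with s hs
    exact norm_sub_pos_S2 hs

theorem tendsto_logDist_atBot (p : S2) :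
    Filter.Tendsto (logDist p) (𝓝[≠] p) Filter.atBot :=
  Real.tendsto_log_nhdsGT_zero.comp (tendsto_norm_sub_S2 p)

/-- The comparison function on the sphere punctured at `y` and at the points of `P`: it has
negative Laplacian, and tends to `∞` at the points of `P` (and to `-∞` at `y`). The weight at `y`
outweighs the points of `P`, each of which contributes `1/2` to the Laplacian. -/
def barrier (P : Finset S2) (y s : S2) : ℝ :=
  ((P.card : ℝ) + 1) * logDist y s - ∑ p ∈ P, logDist p s

theorem smoothAt_barrier {P : Finset S2} {y s : S2} (hy : s ≠ y) (hs : s ∉ P) :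
    SmoothAt (barrier P y) s :=
  ((smoothAt_logDist hy).const_mul _).sub
    (SmoothAt.sum fun _ hp => smoothAt_logDist fun h => hs (h ▸ hp))

theorem sphereLaplacian_barrier {P : Finset S2} {y s : S2} (hy : s ≠ y) (hs : s ∉ P) :
    sphereLaplacian (barrier P y) s = -(1 / 2) := by
  have h1 : ∀ p ∈ P, s ≠ p := fun p hp h => hs (h ▸ hp)
  have h2 := sphereLaplacian_sub ((smoothAt_logDist hy).const_mul ((P.card : ℝ) + 1))
    (SmoothAt.sum fun p hp => smoothAt_logDist (h1 p hp))
  rw [sphereLaplacian_const_mul _ (smoothAt_logDist hy), sphereLaplacian_logDist hy,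
    sphereLaplacian_sum fun p hp => smoothAt_logDist (h1 p hp),
    Finset.sum_congr rfl fun p hp => sphereLaplacian_logDist (h1 p hp), Finset.sum_const,
    nsmul_eq_mul] at h2
  refine Eq.trans h2 ?_
  ring

theorem tendsto_barrier_atTop {P : Finset S2} {y p : S2} (hy : y ∉ P) (hp : p ∈ P) :
    Filter.Tendsto (barrier P y) (𝓝[≠] p) Filter.atTop := by
  classical
  have hpy : p ≠ y := fun h => hy (h ▸ hp)
  have h1 : ContinuousAt (fun s => ((P.card : ℝ) + 1) * logDist y s
      - ∑ q ∈ P.erase p, logDist q s) p :=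
    (((smoothAt_logDist hpy).const_mul _).sub (SmoothAt.sum fun q hq =>
      smoothAt_logDist (Finset.ne_of_mem_erase hq).symm)).continuousAt
  have h2 := (h1.tendsto.mono_left (nhdsWithin_le_nhds (s := {p}ᶜ))).add_atTop
    (Filter.tendsto_neg_atBot_atTop.comp (tendsto_logDist_atBot p))
  refine h2.congr fun s => ?_
  rw [barrier, ← Finset.add_sum_erase P (fun q => logDist q s) hp, Function.comp_apply]
  ring

/-- Removable singularities and Liouville's theorem in one: a harmonic function on the sphere
minus finitely many points, bounded near each of them, is constant. If `f y < f x`, then for small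
`ε` the function `f - ε * barrier P y`, which has positive Laplacian, attains its maximum over the
complement of a small disc around `y` at an interior point. -/
theorem le_of_sphereLaplacian_eq_zero {P : Finset S2} {f : S2 → ℝ}
    (hf : ∀ s ∉ P, SmoothAt f s) (hΔ : ∀ s ∉ P, sphereLaplacian f s = 0)
    (hb : ∀ p ∈ P, ∃ C, ∀ᶠ s in 𝓝[≠] p, |f s| ≤ C) {x y : S2} (hx : x ∉ P) (hy : y ∉ P) :
    f x ≤ f y := by
  by_contra! hlt
  set η : ℝ := (f x - f y) / 2 with hη
  have hηpos : 0 < η := by rw [hη]; linarith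
  have hxy : x ≠ y := by rintro rfl; exact lt_irrefl _ hlt
  have hPc : IsClosed (P : Set S2) := P.finite_toSet.isClosed
  -- a small closed disc around `y`
  obtain ⟨r, hr, hball⟩ : ∃ r > 0, ∀ s ∈ Metric.closedBall y r,
      f s < f y + η ∧ s ∉ P ∧ s ≠ x := by
    refine Metric.nhds_basis_closedBall.eventually_iff.1 ?_
    filter_upwards [(hf y hy).continuousAt.eventually_lt_const (show f y < f y + η by linarith),
      hPc.isOpen_compl.mem_nhds hy, isOpen_ne.mem_nhds hxy.symm] with s h1 h2 h3
    exact ⟨h1, h2, h3⟩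
  have hxr : r < dist x y := by
    by_contra! h
    exact (hball x h).2.2 rfl
  -- the barrier is bounded below on the boundary of the disc
  obtain ⟨m, hm⟩ : ∃ m, ∀ s ∈ Metric.sphere y r, m ≤ barrier P y s := by
    have hc : ContinuousOn (barrier P y) (Metric.sphere y r) := fun s hs =>
      (smoothAt_barrier (by rintro rfl; simp [hr.ne] at hs)
        (hball s (Metric.sphere_subset_closedBall hs)).2.1).continuousAt.continuousWithinAt
    obtain ⟨m, hm⟩ := (isCompact_sphere y r).bddBelow_image hc
    exact ⟨m, fun s hs => hm ⟨s, hs, rfl⟩⟩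
  obtain ⟨ε, hε, hεη⟩ : ∃ ε > 0, ε * (barrier P y x - m) < η := by
    refine ⟨η / (|barrier P y x - m| + 1), by positivity, ?_⟩
    rw [div_mul_eq_mul_div, div_lt_iff₀ (by positivity)]
    have := le_abs_self (barrier P y x - m)
    nlinarith
  set w : S2 → ℝ := fun s => f s - ε * barrier P y s with hw
  have hwsm : ∀ s, s ≠ y → s ∉ P → SmoothAt w s := fun s h1 h2 =>
    (hf s h2).sub ((smoothAt_barrier h1 h2).const_mul ε)
  have hwΔ : ∀ s, s ≠ y → s ∉ P → 0 < sphereLaplacian w s := by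
    intro s h1 h2
    rw [hw, sphereLaplacian_sub (hf s h2) ((smoothAt_barrier h1 h2).const_mul ε), hΔ s h2,
      sphereLaplacian_const_mul _ (smoothAt_barrier h1 h2), sphereLaplacian_barrier h1 h2]
    linarith
  have hwb : ∀ s ∈ Metric.sphere y r, w s < w x := by
    intro s hs
    have h1 := (hball s (Metric.sphere_subset_closedBall hs)).1
    have h2 := mul_le_mul_of_nonneg_left (hm s hs) hε.le
    simp only [hw]
    rw [mul_sub] at hεη
    linarith
  have hV : ∀ p : S2, ∃ V : Set S2, IsOpen V ∧
      (p ∈ P → p ∈ V ∧ ∀ s ∈ V, s ≠ p → w s < w x) := by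
    intro p
    by_cases hp : p ∈ P
    · obtain ⟨C, hC⟩ := hb p hp
      have h1 : ∀ᶠ s in 𝓝[≠] p, w s < w x := by
        filter_upwards [hC, (tendsto_barrier_atTop hy hp).eventually_gt_atTop ((C - w x) / ε)]
          with s h1 h2
        rw [div_lt_iff₀ hε] at h2
        have := le_abs_self (f s)
        simp only [hw] at h2 ⊢
        linarith
      obtain ⟨V, hVo, hpV, hV⟩ := mem_nhdsWithin.1 h1
      exact ⟨V, hVo, fun _ => ⟨hpV, fun s hs hsp => hV ⟨hs, hsp⟩⟩⟩
    · exact ⟨∅, isOpen_empty, fun h => absurd h hp⟩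
  choose V hVo hV using hV
  set K : Set S2 := {s | r ≤ dist s y} ∩ (⋃ p ∈ P, V p)ᶜ with hK
  have hKc : IsCompact K := by
    refine IsClosed.isCompact (IsClosed.inter ?_ ?_)
    · exact isClosed_le continuous_const (continuous_id.dist continuous_const)
    · exact (isOpen_biUnion fun p _ => hVo p).isClosed_compl
  have hKP : ∀ s ∈ K, s ≠ y ∧ s ∉ P := by
    intro s hs
    refine ⟨?_, fun hP => hs.2 (Set.mem_biUnion hP (hV s hP).1)⟩
    rintro rfl
    have := hs.1
    simp at this
    linarith
  have hxK : x ∈ K := by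
    refine ⟨hxr.le, fun h => ?_⟩
    obtain ⟨p, hp, hxp⟩ := Set.mem_iUnion₂.1 h
    exact lt_irrefl _ ((hV p hp).2 x hxp fun h => hx (h ▸ hp))
  obtain ⟨t, htK, ht⟩ := hKc.exists_isMaxOn ⟨x, hxK⟩ fun s hs =>
    (hwsm s (hKP s hs).1 (hKP s hs).2).continuousAt.continuousWithinAt
  have hxt : w x ≤ w t := ht hxK
  have htr : r < dist t y := by
    refine lt_of_le_of_ne htK.1 fun h => ?_
    exact absurd (hwb t h.symm) (not_lt.2 hxt)
  have hmax : IsLocalMax w t := by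
    have hopen : IsOpen {s : S2 | r < dist s y} :=
      isOpen_lt continuous_const (continuous_id.dist continuous_const)
    filter_upwards [hopen.mem_nhds htr, hPc.isOpen_compl.mem_nhds (hKP t htK).2] with s h1 h2
    by_cases hs : s ∈ ⋃ p ∈ P, V p
    · obtain ⟨p, hp, hsp⟩ := Set.mem_iUnion₂.1 hs
      exact ((hV p hp).2 s hsp fun h => h2 (h ▸ hp)).le.trans hxt
    · exact ht ⟨(show r < dist s y from h1).le, hs⟩
  exact absurd (sphereLaplacian_nonpos_of_isLocalMax (hwsm t (hKP t htK).1 (hKP t htK).2) hmax)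
    (not_le.2 (hwΔ t (hKP t htK).1 (hKP t htK).2))

theorem eq_of_sphereLaplacian_eq_zero {P : Finset S2} {f : S2 → ℝ}
    (hf : ∀ s ∉ P, SmoothAt f s) (hΔ : ∀ s ∉ P, sphereLaplacian f s = 0)
    (hb : ∀ p ∈ P, ∃ C, ∀ᶠ s in 𝓝[≠] p, |f s| ≤ C) {x y : S2} (hx : x ∉ P) (hy : y ∉ P) :
    f x = f y :=
  le_antisymm (le_of_sphereLaplacian_eq_zero hf hΔ hb hx hy)
    (le_of_sphereLaplacian_eq_zero hf hΔ hb hy hx)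

/-! ### Short geodesics of the conformal metric -/

theorem norm_tangentProj_le (s : S2) (v : E3) : ‖tangentProj s v‖ ≤ ‖v‖ := by
  have h1 : ‖tangentProj s v‖ ^ 2 = ‖v‖ ^ 2 - inner ℝ (s : E3) v ^ 2 := by
    rw [tangentProj_apply, norm_sub_sq_real, norm_smul, norm_coe_S2, inner_smul_right,
      real_inner_comm, Real.norm_eq_abs, mul_one, sq_abs]
    ring
  refine (pow_le_pow_iff_left₀ (norm_nonneg _) (norm_nonneg v) two_ne_zero).1 ?_
  rw [h1]
  linarith [sq_nonneg (inner ℝ (s : E3) v)]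

theorem hasFDerivAt_coe_retract_of_ne_zero {x : E3} (hx : x ≠ 0) :
    HasFDerivAt (fun y : E3 => (retract y : E3)) (‖x‖⁻¹ • tangentProj (retract x)) x := by
  have hx' : 0 < ‖x‖⁻¹ := inv_pos.2 (norm_pos_iff.2 hx)
  have h1 : (fun y : E3 => (retract y : E3)) = fun y => (retract (‖x‖⁻¹ • y) : E3) := by
    funext y
    by_cases hy : y = 0
    · simp [hy]
    · rw [coe_retract hy, coe_retract (smul_ne_zero hx'.ne' hy), norm_smul, smul_smul,
        Real.norm_eq_abs, abs_of_pos hx', mul_inv, mul_right_comm, inv_mul_cancel₀ hx'.ne', one_mul]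
  have h2 : HasFDerivAt (fun y : E3 => ‖x‖⁻¹ • y) (‖x‖⁻¹ • ContinuousLinearMap.id ℝ E3) x :=
    (hasFDerivAt_id x).fun_const_smul _
  have h3 : HasFDerivAt (fun y : E3 => (retract y : E3)) (tangentProj (retract x))
      (‖x‖⁻¹ • x) := by
    rw [← coe_retract hx]
    exact hasFDerivAt_coe_retract (retract x)
  rw [h1]
  refine (h3.comp x h2).congr_fderiv ?_
  ext1 v
  simp

/-- The speed of a curve on the unit interval (one-sided at the ends) for the round metric. -/
def speed (c : ℝ → S2) (t : ℝ) : ℝ :=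
  ‖derivWithin (fun t => (c t : E3)) (Set.Icc 0 1) t‖

theorem continuousOn_speed {c : ℝ → S2}
    (hc : ContDiffOn ℝ 1 (fun t => (c t : E3)) (Set.Icc 0 1)) :
    ContinuousOn (speed c) (Set.Icc 0 1) :=
  (hc.continuousOn_derivWithin (uniqueDiffOn_Icc zero_lt_one) le_rfl).norm

theorem continuousOn_curve {c : ℝ → S2}
    (hc : ContDiffOn ℝ 1 (fun t => (c t : E3)) (Set.Icc 0 1)) :
    ContinuousOn c (Set.Icc 0 1) :=
  continuousOn_iff_continuous_domRestrict.2
    (continuous_induced_rng.2 (continuousOn_iff_continuous_domRestrict.1 hc.continuousOn))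

theorem intervalIntegrable_mul_speed {c : ℝ → S2}
    (hc : ContDiffOn ℝ 1 (fun t => (c t : E3)) (Set.Icc 0 1)) {k : ℝ → ℝ}
    (hk : ContinuousOn k (Set.Icc 0 1)) :
    IntervalIntegrable (fun t => k t * speed c t) MeasureTheory.volume 0 1 := by
  apply ContinuousOn.intervalIntegrable
  rw [Set.uIcc_of_le zero_le_one]
  exact hk.mul (continuousOn_speed hc)

/-- A function whose gradient along the curve is bounded by `k` decreases along any final part of
the curve at most by the integral of `k` along the curve. -/
theorem sub_le_integral_of_calibration {c : ℝ → S2}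
    (hc : ContDiffOn ℝ 1 (fun t => (c t : E3)) (Set.Icc 0 1)) {φ : E3 → ℝ} {φ' : E3 → E3}
    (hφ : ∀ y, HasGradientAt φ (φ' y) y) {k : ℝ → ℝ} (hk : ContinuousOn k (Set.Icc 0 1))
    (hφk : ∀ t ∈ Set.Icc (0 : ℝ) 1, ‖φ' (c t)‖ ≤ k t) {t₀ : ℝ} (ht₀ : t₀ ∈ Set.Icc (0 : ℝ) 1) :
    φ (c t₀) - φ (c 1) ≤ ∫ t in (0 : ℝ)..1, k t * speed c t := by
  have hsub : Set.Icc t₀ 1 ⊆ Set.Icc (0 : ℝ) 1 := Set.Icc_subset_Icc_left ht₀.1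
  have hφc : Continuous φ :=
    continuous_iff_continuousAt.2 fun y => (hφ y).differentiableAt.continuousAt
  have hint := intervalIntegrable_mul_speed hc hk
  have h1 : -φ (c 1) - -φ (c t₀) ≤ ∫ t in t₀..1, k t * speed c t := by
    refine intervalIntegral.sub_le_integral_of_hasDeriv_right_of_le
      (g := fun t => -φ (c t))
      (g' := fun t => -inner ℝ (φ' (c t)) (derivWithin (fun t => (c t : E3)) (Set.Icc 0 1) t))
      ht₀.2 ((hφc.comp_continuousOn hc.continuousOn).mono hsub).neg ?_ ?_ ?_
    · intro t ht
      have ht' : t ∈ Set.Icc (0 : ℝ) 1 := hsub (Set.Ioo_subset_Icc_self ht)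
      have h2 : HasDerivAt (fun t => (c t : E3))
          (derivWithin (fun t => (c t : E3)) (Set.Icc 0 1) t) t :=
        ((hc.differentiableOn one_ne_zero) t ht').hasDerivWithinAt.hasDerivAt
          (Icc_mem_nhds (ht₀.1.trans_lt ht.1) ht.2)
      have h3 := (hφ (c t)).hasFDerivAt.comp_hasDerivAt t h2
      exact h3.neg.hasDerivWithinAt
    · exact ((hk.mul (continuousOn_speed hc)).mono hsub).integrableOn_Icc
    · intro t ht
      have ht' : t ∈ Set.Icc (0 : ℝ) 1 := hsub (Set.Ioo_subset_Icc_self ht)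
      refine (neg_le_abs _).trans ((abs_real_inner_le_norm _ _).trans ?_)
      exact mul_le_mul_of_nonneg_right (hφk t ht') (norm_nonneg _)
  have h2 : ∫ t in t₀..1, k t * speed c t ≤ ∫ t in (0 : ℝ)..1, k t * speed c t := by
    refine intervalIntegral.integral_mono_interval ht₀.1 ht₀.2 le_rfl ?_ hint
    refine (MeasureTheory.ae_restrict_iff' measurableSet_Ioc).2 (Filter.Eventually.of_forall ?_)
    intro t ht
    exact mul_nonneg ((norm_nonneg _).trans (hφk t (Set.Ioc_subset_Icc_self ht))) (norm_nonneg _)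
  linarith

/-- The `g`-length of a curve, for `g = h² g_o`. -/
def gLength (h : S2 → ℝ) (c : ℝ → S2) : ℝ := ∫ t in (0 : ℝ)..1, h (c t) * speed c t

/-- Where `h ≥ m`, distances to the endpoint are at most `length / m` along the curve. -/
theorem norm_sub_le_gLength {h : S2 → ℝ} (hh : Continuous h) {m : ℝ} (hm : 0 < m)
    (hmh : ∀ s, m ≤ h s) {c : ℝ → S2}
    (hc : ContDiffOn ℝ 1 (fun t => (c t : E3)) (Set.Icc 0 1)) {t₀ : ℝ}
    (ht₀ : t₀ ∈ Set.Icc (0 : ℝ) 1) : m * ‖(c t₀ : E3) - (c 1 : E3)‖ ≤ gLength h c := by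
  set v : E3 := (c t₀ : E3) - (c 1 : E3) with hv
  set e : E3 := ‖v‖⁻¹ • v with he
  have he1 : ‖e‖ ≤ 1 := by
    rw [he, norm_smul, norm_inv, norm_norm]
    exact inv_mul_le_one
  have h1 := sub_le_integral_of_calibration hc (φ := fun y => m * inner ℝ e y)
    (φ' := fun _ => m • e) (k := fun t => h (c t)) (fun y => ?_)
    (hh.comp_continuousOn (continuousOn_curve hc)) (fun t _ => ?_) ht₀
  · have h2 : m * inner ℝ e (c t₀ : E3) - m * inner ℝ e (c 1 : E3) = m * ‖v‖ := by
      rw [← mul_sub, ← inner_sub_right, ← hv, he, inner_smul_left, real_inner_self_eq_norm_sq]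
      rcases eq_or_ne ‖v‖ 0 with h0 | h0
      · simp [h0]
      · simp [sq, h0]
    rw [← h2]
    exact h1
  · rw [hasGradientAt_iff_hasFDerivAt]
    refine ((innerSL ℝ e).hasFDerivAt.const_mul m).congr_fderiv ?_
    ext1 w
    simp
  · rw [norm_smul, Real.norm_eq_abs, abs_of_pos hm]
    exact (mul_le_of_le_one_right hm.le he1).trans (hmh _)

/-- The gradient of the function that calibrates the curves from `p` in direction `u`, for the
conformal factor `h₀ + ⟨a, y - p⟩`. -/
theorem hasGradientAt_calibration (h₀ : ℝ) (a u p y : E3) :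
    HasGradientAt (fun y => h₀ * inner ℝ u (y - p) + inner ℝ a (y - p) * inner ℝ u (y - p)
        - 1 / 2 * inner ℝ a u * inner ℝ u (y - p) ^ 2)
      ((h₀ + inner ℝ a (y - p)) • u + inner ℝ u (y - p) • (a - inner ℝ a u • u)) y := by
  rw [hasGradientAt_iff_hasFDerivAt]
  have h1 : ∀ b : E3, HasFDerivAt (fun y : E3 => inner ℝ b (y - p)) (innerSL ℝ b) y := fun b =>
    (innerSL ℝ b).hasFDerivAt.comp y ((hasFDerivAt_id y).sub_const p)
  refine ((((h1 u).const_mul h₀).add ((h1 a).mul (h1 u))).sub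
    (((h1 u).pow 2).const_mul (1 / 2 * inner ℝ a u))).congr_fderiv ?_
  ext1 w
  simp
  ring

/-- The gradient of the calibrating function exceeds the linearized conformal factor in second
order only. -/
theorem norm_calibration_le {h₀ A B : ℝ} (hh₀ : 0 < h₀) (hA : h₀ / 2 ≤ A) {a u : E3}
    (hu : ‖u‖ = 1) : ‖A • u + B • (a - inner ℝ a u • u)‖ ≤ A + ‖a‖ ^ 2 * B ^ 2 / h₀ := by
  have h1 : ‖A • u + B • (a - inner ℝ a u • u)‖ ^ 2
      = A ^ 2 + B ^ 2 * (‖a‖ ^ 2 - inner ℝ a u ^ 2) := by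
    have huu : inner ℝ u u = 1 := by rw [real_inner_self_eq_norm_sq, hu, one_pow]
    rw [← real_inner_self_eq_norm_sq, ← real_inner_self_eq_norm_sq]
    simp only [inner_add_left, inner_add_right, inner_sub_left, inner_sub_right, inner_smul_left,
      inner_smul_right, huu, conj_trivial, real_inner_comm a u]
    ring
  have h2 : 0 ≤ ‖a‖ ^ 2 * B ^ 2 / h₀ := by positivity
  refine (pow_le_pow_iff_left₀ (norm_nonneg _) (by linarith) two_ne_zero).1 ?_
  rw [h1]
  have h3 : ‖a‖ ^ 2 * B ^ 2 = h₀ * (‖a‖ ^ 2 * B ^ 2 / h₀) := by field_simp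
  nlinarith [sq_nonneg (B * inner ℝ a u)]

/-- Lower bound for the length of the curves from `s` to `p`, by calibration. The conformal factor
is compared with its linearization `h p + ⟨a, r - p⟩` in the ball of radius `M * |s - p|`, which
contains every curve that is not much longer than the chord. -/
theorem le_gLength {h : S2 → ℝ} (hh : Continuous h) {m : ℝ} (hm : 0 < m)
    (hmh : ∀ s, m ≤ h s) {a : E3} {s p : S2} (hsp : s ≠ p) {η M : ℝ} (hη : 0 ≤ η)
    (hM : M = 2 * h p / m)
    (hexp : ∀ r : S2, ‖(r : E3) - p‖ ≤ M * ‖(s : E3) - p‖ →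
      h p + inner ℝ a ((r : E3) - p) - η * ‖(r : E3) - p‖ ≤ h r)
    (hsmall : ‖a‖ * (M * ‖(s : E3) - p‖) ≤ h p / 2)
    {c : ℝ → S2} (hc : ContDiffOn ℝ 1 (fun t => (c t : E3)) (Set.Icc 0 1)) (hc0 : c 0 = s)
    (hc1 : c 1 = p) :
    ‖(s : E3) - p‖ * (h p + 1 / 2 * inner ℝ a ((s : E3) - p)) ≤
      (1 + (η * M + ‖a‖ ^ 2 * M ^ 2 * ‖(s : E3) - p‖ / h p) / m * ‖(s : E3) - p‖)
        * gLength h c := by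
  set ε : ℝ := ‖(s : E3) - p‖ with hε
  have hε0 : 0 < ε := norm_sub_pos_S2 hsp
  have hp : 0 < h p := hm.trans_le (hmh p)
  have hM2 : 2 ≤ M := by
    rw [hM, le_div_iff₀ hm]; linarith [hmh p]
  have hM0 : 0 < M := by linarith
  have haε : inner ℝ a ((s : E3) - p) ≤ h p / 2 := by
    refine (real_inner_le_norm _ _).trans (le_trans ?_ hsmall)
    rw [← hε]
    exact mul_le_mul_of_nonneg_left (le_mul_of_one_le_left hε0.le (by linarith)) (norm_nonneg a)
  have hL0 : 0 ≤ gLength h c := by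
    have := norm_sub_le_gLength hh hm hmh hc (t₀ := 0) (by simp)
    exact le_trans (by positivity) this
  set θ : ℝ := (η * M + ‖a‖ ^ 2 * M ^ 2 * ε / h p) / m * ε with hθ
  have hθ0 : 0 ≤ θ := by positivity
  rcases lt_or_ge (2 * h p * ε) (gLength h c) with hlong | hshort
  · -- a curve much longer than the chord satisfies the bound trivially
    nlinarith
  -- the curve stays in the ball where `h` is close to its linearization
  have hball : ∀ t ∈ Set.Icc (0 : ℝ) 1, ‖(c t : E3) - p‖ ≤ M * ε := by
    intro t ht
    have h1 := norm_sub_le_gLength hh hm hmh hc ht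
    rw [hc1] at h1
    rw [hM, div_mul_eq_mul_div, le_div_iff₀ hm]
    linarith
  set u : E3 := ε⁻¹ • ((s : E3) - p) with hu
  have hu1 : ‖u‖ = 1 := by
    rw [hu, norm_smul, norm_inv, Real.norm_eq_abs, abs_of_pos hε0, ← hε, inv_mul_cancel₀ hε0.ne']
  have hus : inner ℝ u ((s : E3) - p) = ε := by
    rw [hu, inner_smul_left, real_inner_self_eq_norm_sq, ← hε]
    simp [sq, hε0.ne']
  have hau : inner ℝ a u * ε = inner ℝ a ((s : E3) - p) := by
    rw [hu, inner_smul_right]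
    field_simp
  have h1 := sub_le_integral_of_calibration hc (t₀ := 0)
    (hasGradientAt_calibration (h p) a u p) (k := fun t => (1 + θ) * h (c t))
    (continuousOn_const.mul (hh.comp_continuousOn (continuousOn_curve hc))) (fun t ht => ?_)
    (by simp)
  · simp only [hc0, hc1, sub_self, inner_zero_right, hus, mul_assoc] at h1
    rw [intervalIntegral.integral_const_mul, ← gLength] at h1
    refine le_trans (le_of_eq ?_) h1
    rw [← hau]
    ring
  · have hct := hball t ht
    have hn := norm_nonneg ((c t : E3) - p)
    have h2 : |inner ℝ a ((c t : E3) - p)| ≤ h p / 2 :=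
      (abs_real_inner_le_norm _ _).trans
        ((mul_le_mul_of_nonneg_left hct (norm_nonneg a)).trans hsmall)
    have h3 : inner ℝ u ((c t : E3) - p) ^ 2 ≤ (M * ε) ^ 2 := by
      have h4 := abs_real_inner_le_norm u ((c t : E3) - p)
      rw [hu1, one_mul] at h4
      rw [← sq_abs]
      exact pow_le_pow_left₀ (abs_nonneg _) (h4.trans hct) 2
    refine (norm_calibration_le hp (by linarith [neg_le_of_abs_le h2]) hu1).trans ?_
    have h4 := hexp (c t) hct
    have h5 : η * ‖(c t : E3) - p‖ ≤ η * (M * ε) := mul_le_mul_of_nonneg_left hct hη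
    have h6 : ‖a‖ ^ 2 * inner ℝ u ((c t : E3) - p) ^ 2 / h p ≤ ‖a‖ ^ 2 * (M * ε) ^ 2 / h p := by
      gcongr
    have h7 : θ * m ≤ θ * h (c t) := mul_le_mul_of_nonneg_left (hmh _) hθ0
    have h8 : θ * m = η * (M * ε) + ‖a‖ ^ 2 * (M * ε) ^ 2 / h p := by
      rw [hθ]; field_simp
    linarith

/-- The short arc of the great circle from `s` to `p`, as the projection of the chord. -/
def arc (s p : S2) (t : ℝ) : S2 := retract ((p : E3) + (1 - t) • ((s : E3) - p))

theorem arc_zero (s p : S2) : arc s p 0 = s := by simp [arc]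

theorem arc_one (s p : S2) : arc s p 1 = p := by simp [arc]

theorem norm_sq_chord (s p : S2) (t : ℝ) : ‖(p : E3) + (1 - t) • ((s : E3) - p)‖ ^ 2
    = 1 - t * (1 - t) * ‖(s : E3) - p‖ ^ 2 := by
  rw [norm_add_sq_real, norm_smul, mul_pow, norm_sub_sq_S2, inner_smul_right, inner_sub_right,
    inner_self_S2, norm_coe_S2, Real.norm_eq_abs, sq_abs, real_inner_comm]
  ring

theorem one_sub_sq_le_norm_chord (s p : S2) {t : ℝ}
    (ht : t ∈ Set.Icc (0 : ℝ) 1) :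
    1 - ‖(s : E3) - p‖ ^ 2 / 4 ≤ ‖(p : E3) + (1 - t) • ((s : E3) - p)‖ ∧
      ‖(p : E3) + (1 - t) • ((s : E3) - p)‖ ≤ 1 := by
  have h1 := norm_sq_chord s p t
  set ε : ℝ := ‖(s : E3) - p‖
  set x : ℝ := ‖(p : E3) + (1 - t) • ((s : E3) - p)‖
  have hx : 0 ≤ x := norm_nonneg _
  have hε : 0 ≤ ε := norm_nonneg _
  have h2 : t * (1 - t) ≤ 1 / 4 := by nlinarith [sq_nonneg (t - 1 / 2)]
  have h3 : 0 ≤ t * (1 - t) := mul_nonneg ht.1 (by linarith [ht.2])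
  have h4 : x ≤ 1 := by nlinarith [mul_nonneg h3 (sq_nonneg ε)]
  refine ⟨?_, h4⟩
  nlinarith [mul_le_mul_of_nonneg_right h2 (sq_nonneg ε)]

theorem chord_ne_zero {s p : S2} (hsp : ‖(s : E3) - p‖ ≤ 1) {t : ℝ}
    (ht : t ∈ Set.Icc (0 : ℝ) 1) : (p : E3) + (1 - t) • ((s : E3) - p) ≠ 0 := by
  rw [← norm_pos_iff]
  have h1 := (one_sub_sq_le_norm_chord s p ht).1
  have h2 : ‖(s : E3) - p‖ ^ 2 ≤ 1 := pow_le_one₀ (norm_nonneg _) hsp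
  linarith

theorem contDiffOn_arc {s p : S2} (hsp : ‖(s : E3) - p‖ ≤ 1) :
    ContDiffOn ℝ 1 (fun t => (arc s p t : E3)) (Set.Icc 0 1) := by
  intro t ht
  have h1 : ContDiffAt ℝ 1 (fun t : ℝ => (p : E3) + (1 - t) • ((s : E3) - p)) t := by fun_prop
  have h2 : ContDiffAt ℝ 1 (fun x : E3 => (retract x : E3)) ((p : E3) + (1 - t) • ((s : E3) - p)) :=
    (contDiffAt_coe_retract (chord_ne_zero hsp ht)).of_le (by simp)
  exact (ContDiffAt.comp t h2 h1).contDiffWithinAt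

theorem speed_arc_le {s p : S2} (hsp : ‖(s : E3) - p‖ ≤ 1) {t : ℝ}
    (ht : t ∈ Set.Icc (0 : ℝ) 1) :
    speed (arc s p) t ≤ ‖(s : E3) - p‖ * (1 + ‖(s : E3) - p‖ ^ 2) := by
  set ε : ℝ := ‖(s : E3) - p‖ with hεdef
  have hε : 0 ≤ ε := norm_nonneg _
  have h1 : HasDerivAt (fun t : ℝ => (p : E3) + (1 - t) • ((s : E3) - p)) (-((s : E3) - p)) t := by
    simpa using (((hasDerivAt_id t).const_sub 1).smul_const ((s : E3) - p)).const_add (p : E3)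
  have h2 := (hasFDerivAt_coe_retract_of_ne_zero (chord_ne_zero hsp ht)).comp_hasDerivAt t h1
  have h3 : derivWithin (fun t => (arc s p t : E3)) (Set.Icc 0 1) t = _ :=
    h2.hasDerivWithinAt.derivWithin (uniqueDiffOn_Icc zero_lt_one t ht)
  rw [speed, h3, smul_apply, norm_smul, norm_inv, norm_norm]
  have h4 := one_sub_sq_le_norm_chord s p ht
  rw [← hεdef] at h4
  have h5 : ε ^ 2 ≤ 1 := pow_le_one₀ hε hsp
  have h6 : ‖tangentProj (retract ((p : E3) + (1 - t) • ((s : E3) - p))) (-((s : E3) - p))‖ ≤ ε :=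
    (norm_tangentProj_le _ _).trans (by rw [norm_neg])
  have h7 : ‖(p : E3) + (1 - t) • ((s : E3) - p)‖⁻¹ ≤ 1 + ε ^ 2 := by
    rw [inv_le_iff_one_le_mul₀ (by linarith)]
    nlinarith [mul_le_mul_of_nonneg_left h4.1 (show 0 ≤ 1 + ε ^ 2 by positivity)]
  rw [mul_comm ε]
  exact mul_le_mul h7 h6 (norm_nonneg _) (by positivity)

theorem norm_arc_sub_chord_le {s p : S2} (hsp : ‖(s : E3) - p‖ ≤ 1) {t : ℝ}
    (ht : t ∈ Set.Icc (0 : ℝ) 1) :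
    ‖(arc s p t : E3) - ((p : E3) + (1 - t) • ((s : E3) - p))‖ ≤ ‖(s : E3) - p‖ ^ 2 := by
  have h4 := one_sub_sq_le_norm_chord s p ht
  have h0 := chord_ne_zero hsp ht
  rw [arc, coe_retract h0]
  set x : E3 := (p : E3) + (1 - t) • ((s : E3) - p)
  have hx : 0 < ‖x‖ := norm_pos_iff.2 h0
  have h5 : ‖x‖⁻¹ • x - x = (‖x‖⁻¹ - 1) • x := by rw [sub_smul, one_smul]
  rw [h5, norm_smul, Real.norm_eq_abs, abs_of_nonneg (by linarith [(one_le_inv₀ hx).2 h4.2]),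
    sub_mul, inv_mul_cancel₀ hx.ne']
  linarith [sq_nonneg ‖(s : E3) - p‖]

/-- Upper bound for the length of the great circle arc: the arc deviates from the chord, along which
the linearization of `h` has the mean value `h p + ½ ⟨a, s - p⟩`, in second order only. -/
theorem gLength_arc_le {h : S2 → ℝ} (hh : Continuous h) (hpos : ∀ s, 0 < h s) {a : E3}
    {s p : S2} {η : ℝ} (hη : 0 ≤ η)
    (hexp : ∀ r : S2, ‖(r : E3) - p‖ ≤ 2 * ‖(s : E3) - p‖ →
      h r ≤ h p + inner ℝ a ((r : E3) - p) + η * ‖(r : E3) - p‖)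
    (hsp : ‖(s : E3) - p‖ ≤ 1) :
    gLength h (arc s p) ≤ ‖(s : E3) - p‖ * (1 + ‖(s : E3) - p‖ ^ 2) *
      (h p + 1 / 2 * inner ℝ a ((s : E3) - p)
        + (‖a‖ * ‖(s : E3) - p‖ ^ 2 + 2 * η * ‖(s : E3) - p‖)) := by
  have hc := contDiffOn_arc hsp
  set ε : ℝ := ‖(s : E3) - p‖ with hεdef
  have hε : 0 ≤ ε := norm_nonneg _
  set b : ℝ := inner ℝ a ((s : E3) - p) with hb
  have h1 : ∀ t ∈ Set.Icc (0 : ℝ) 1, h (arc s p t) * speed (arc s p) t ≤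
      ε * (1 + ε ^ 2) * (h p + (‖a‖ * ε ^ 2 + 2 * η * ε) + (1 - t) * b) := by
    intro t ht
    have h2 := norm_arc_sub_chord_le hsp ht
    rw [← hεdef] at h2
    set q : E3 := (arc s p t : E3) - ((p : E3) + (1 - t) • ((s : E3) - p)) with hq
    have h3 : (arc s p t : E3) - p = q + (1 - t) • ((s : E3) - p) := by rw [hq]; abel
    have h4 : ‖(arc s p t : E3) - p‖ ≤ 2 * ε := by
      rw [h3]
      refine (norm_add_le _ _).trans ?_
      rw [norm_smul, ← hεdef, Real.norm_eq_abs, abs_of_nonneg (by linarith [ht.2])]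
      nlinarith [ht.1]
    have h5 := hexp _ h4
    have h6 : inner ℝ a ((arc s p t : E3) - p) ≤ ‖a‖ * ε ^ 2 + (1 - t) * b := by
      rw [h3, inner_add_right, inner_smul_right, ← hb]
      have := (real_inner_le_norm a q).trans (mul_le_mul_of_nonneg_left h2 (norm_nonneg a))
      linarith
    have h7 : η * ‖(arc s p t : E3) - p‖ ≤ η * (2 * ε) := mul_le_mul_of_nonneg_left h4 hη
    have h8 : h (arc s p t) ≤ h p + (‖a‖ * ε ^ 2 + 2 * η * ε) + (1 - t) * b := by linarith
    rw [mul_comm]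
    exact mul_le_mul (speed_arc_le hsp ht) h8 (hpos _).le (by positivity)
  have h2 : Continuous fun t : ℝ =>
      ε * (1 + ε ^ 2) * (h p + (‖a‖ * ε ^ 2 + 2 * η * ε) + (1 - t) * b) := by fun_prop
  refine (intervalIntegral.integral_mono_on zero_le_one
    (intervalIntegrable_mul_speed hc (hh.comp_continuousOn (continuousOn_curve hc)))
    (h2.intervalIntegrable 0 1) h1).trans (le_of_eq ?_)
  rw [intervalIntegral.integral_const_mul, intervalIntegral.integral_add (by simp)
    (Continuous.intervalIntegrable (by fun_prop) 0 1), intervalIntegral.integral_mul_const,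
    intervalIntegral.integral_sub (by simp) (by simp)]
  simp
  left
  ring

theorem gLength_nonneg {h : S2 → ℝ} (hpos : ∀ s, 0 < h s) (c : ℝ → S2) : 0 ≤ gLength h c :=
  intervalIntegral.integral_nonneg zero_le_one fun _ _ =>
    mul_nonneg (hpos _).le (norm_nonneg _)

theorem geoDist_eq (h : S2 → ℝ) (p q : S2) : geoDist h p q =
    sInf {L : ℝ | ∃ c : ℝ → S2, ContDiffOn ℝ 1 (fun t => (c t : E3)) (Set.Icc 0 1) ∧
      c 0 = p ∧ c 1 = q ∧ L = gLength h c} := rfl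

theorem geoDist_le_gLength_arc {h : S2 → ℝ} (hpos : ∀ s, 0 < h s) {s p : S2}
    (hsp : ‖(s : E3) - p‖ ≤ 1) : geoDist h s p ≤ gLength h (arc s p) := by
  rw [geoDist_eq]
  refine csInf_le ⟨0, ?_⟩ ⟨arc s p, contDiffOn_arc hsp, arc_zero s p, arc_one s p, rfl⟩
  rintro _ ⟨c, _, _, _, rfl⟩
  exact gLength_nonneg hpos c

theorem le_geoDist {h : S2 → ℝ} {s p : S2} (hsp : ‖(s : E3) - p‖ ≤ 1) {x : ℝ}
    (hx : ∀ c : ℝ → S2, ContDiffOn ℝ 1 (fun t => (c t : E3)) (Set.Icc 0 1) → c 0 = s → c 1 = p →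
      x ≤ gLength h c) : x ≤ geoDist h s p := by
  rw [geoDist_eq]
  refine le_csInf ⟨_, arc s p, contDiffOn_arc hsp, arc_zero s p, arc_one s p, rfl⟩ ?_
  rintro _ ⟨c, hc, h0, h1, rfl⟩
  exact hx c hc h0 h1

/-- First order expansion of a smooth function in the Euclidean displacement. -/
theorem isLittleO_sphereGrad {f : S2 → ℝ} {p : S2} (hf : SmoothAt f p) :
    (fun s : S2 => f s - f p - inner ℝ (sphereGrad f p) ((s : E3) - p))
      =o[𝓝 p] fun s : S2 => ‖(s : E3) - p‖ := by
  have h1 := (hasGradientAt_iff_isLittleO.1 hf.differentiableAt.hasGradientAt).comp_tendsto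
    (tendsto_coe_S2 p)
  simpa [Function.comp_def, sphereGrad] using h1.norm_right

theorem exists_pos_le {h : S2 → ℝ} (hh : Continuous h) (hpos : ∀ s, 0 < h s) :
    ∃ m, 0 < m ∧ ∀ s, m ≤ h s := by
  obtain ⟨s, -, hs⟩ := isCompact_univ.exists_isMinOn
    ⟨retract 0, Set.mem_univ _⟩ hh.continuousOn
  exact ⟨h s, hpos s, fun r => hs (Set.mem_univ r)⟩

theorem tendsto_norm_sub_nhds (p : S2) :
    Filter.Tendsto (fun s : S2 => ‖(s : E3) - (p : E3)‖) (𝓝[≠] p) (𝓝 0) :=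
  (tendsto_norm_sub_S2 p).mono_right nhdsWithin_le_nhds

/-- Second order expansion `d(s, p) = |s - p| (h p + ½ ⟨∇h, s - p⟩) + o(|s - p|²)` of the geodesic
distance, divided by `|s - p|`. -/
theorem isLittleO_geoDist {h : S2 → ℝ} (hsmooth : ContMDiff (𝓡 2) 𝓘(ℝ, ℝ) ∞ h)
    (hpos : ∀ s, 0 < h s) (p : S2) :
    (fun s : S2 => geoDist h s p / ‖(s : E3) - p‖
        - (h p + 1 / 2 * inner ℝ (sphereGrad h p) ((s : E3) - p)))
      =o[𝓝[≠] p] fun s : S2 => ‖(s : E3) - p‖ := by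
  have hh : Continuous h := hsmooth.continuous
  obtain ⟨m, hm, hmh⟩ := exists_pos_le hh hpos
  set a : E3 := sphereGrad h p with ha
  set M : ℝ := 2 * h p / m with hM
  have hp := hpos p
  have hM2 : 2 ≤ M := by rw [hM, le_div_iff₀ hm]; linarith [hmh p]
  -- the relative error `θ` of the calibration, divided by the length of the chord
  set τ : ℝ → ℝ → ℝ := fun η ε => (η * M + ‖a‖ ^ 2 * M ^ 2 * ε / h p) / m with hτ
  refine Asymptotics.isLittleO_iff.2 fun C hC => ?_
  -- `η` bounds the error of the linearization of `h`; the two inequalities are the limits, for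
  -- short chords, of what the lower and the upper bound require
  obtain ⟨η, hη, hη1, hη2⟩ : ∃ η > 0, 2 * h p * (η * M / m) < C ∧ 4 * η < C := by
    refine ⟨C / (2 * h p * M / m + 5), by positivity, ?_, ?_⟩
    · have : 2 * h p * (C / (2 * h p * M / m + 5) * M / m)
          = C * ((2 * h p * M / m) / (2 * h p * M / m + 5)) := by field_simp
      rw [this]
      refine mul_lt_of_lt_one_right hC ?_
      rw [div_lt_one (by positivity)]
      linarith
    · rw [mul_div_assoc', div_lt_iff₀ (by positivity)]
      nlinarith [show 0 < 2 * h p * M / m by positivity]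
  obtain ⟨δ, hδ, hδh⟩ : ∃ δ > 0, ∀ r : S2, ‖(r : E3) - p‖ < δ →
      |h r - h p - inner ℝ a ((r : E3) - p)| ≤ η * ‖(r : E3) - p‖ := by
    have h1 := (isLittleO_sphereGrad (contDiffAt_comp_retract hsmooth p)).def hη
    obtain ⟨δ, hδ, h2⟩ := Metric.eventually_nhds_iff.1 h1
    refine ⟨δ, hδ, fun r hr => ?_⟩
    have h3 := h2 (y := r) (by rw [Subtype.dist_eq, dist_eq_norm]; exact hr)
    rwa [norm_norm, Real.norm_eq_abs] at h3
  have hsmall : ∀ {φ : ℝ → ℝ} {b : ℝ}, Continuous φ → φ 0 < b →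
      ∀ᶠ s : S2 in 𝓝[≠] p, φ ‖(s : E3) - p‖ < b := fun hφ hb =>
    ((hφ.tendsto 0).comp (tendsto_norm_sub_nhds p)).eventually_lt_const hb
  filter_upwards [self_mem_nhdsWithin,
    hsmall continuous_id (show id 0 < (1 : ℝ) by simp),
    hsmall (φ := fun ε => M * ε) (by fun_prop) (show M * 0 < δ by simpa using hδ),
    hsmall (φ := fun ε => ‖a‖ * (M * ε)) (by fun_prop)
      (show ‖a‖ * (M * 0) < h p / 2 by simpa using hp),
    hsmall (φ := fun ε => 2 * h p * τ η ε) (by simp only [hτ]; fun_prop)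
      (show 2 * h p * τ η 0 < C by simpa [hτ] using hη1),
    hsmall (φ := fun ε => ε * (2 * h p) + 2 * (‖a‖ * ε + 2 * η)) (by fun_prop)
      (show 0 * (2 * h p) + 2 * (‖a‖ * 0 + 2 * η) < C by linarith)]
    with s hs h1 h2 h3 h4 h5
  set ε : ℝ := ‖(s : E3) - p‖ with hε
  have hε0 : 0 < ε := norm_sub_pos_S2 hs
  have hε1 : ε ≤ 1 := le_of_lt h1
  set X : ℝ := h p + 1 / 2 * inner ℝ a ((s : E3) - p) with hX
  have hXb : |X - h p| ≤ h p / 2 := by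
    have h6 := abs_real_inner_le_norm a ((s : E3) - p)
    rw [← hε] at h6
    have h7 : ‖a‖ * ε ≤ ‖a‖ * (M * ε) :=
      mul_le_mul_of_nonneg_left (le_mul_of_one_le_left hε0.le (by linarith)) (norm_nonneg a)
    rw [hX, add_sub_cancel_left, abs_mul, abs_of_pos (by norm_num : (0 : ℝ) < 1 / 2)]
    linarith [abs_nonneg (inner ℝ a ((s : E3) - p))]
  obtain ⟨hX1, hX2⟩ := abs_le.1 hXb
  have hupper : geoDist h s p ≤ ε * (1 + ε ^ 2) * (X + (‖a‖ * ε ^ 2 + 2 * η * ε)) := by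
    refine (geoDist_le_gLength_arc hpos hε1).trans (gLength_arc_le hh hpos hη.le ?_ hε1)
    intro r hr
    have h6 : 2 * ε ≤ M * ε := mul_le_mul_of_nonneg_right hM2 hε0.le
    have := (abs_le.1 (hδh r (by linarith))).2
    linarith
  have hlower : ε * X ≤ (1 + τ η ε * ε) * geoDist h s p := by
    have hτ0 : 0 ≤ τ η ε := by positivity
    rw [← div_le_iff₀' (by positivity)]
    refine le_geoDist hε1 fun c hc hc0 hc1 => ?_
    rw [div_le_iff₀' (by positivity)]
    refine le_gLength hh hm hmh hs hη.le hM ?_ h3.le hc hc0 hc1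
    intro r hr
    have := (abs_le.1 (hδh r (by linarith))).1
    linarith
  have hτ0 : 0 ≤ τ η ε := by positivity
  have hd : ε * (geoDist h s p / ε) = geoDist h s p := mul_div_cancel₀ _ hε0.ne'
  set D : ℝ := geoDist h s p / ε with hD
  rw [← hd, mul_assoc] at hupper
  rw [← hd, mul_left_comm] at hlower
  have hu := le_of_mul_le_mul_left hupper hε0
  have hl := le_of_mul_le_mul_left hlower hε0
  rw [norm_norm, Real.norm_eq_abs, abs_le]
  have hna := norm_nonneg a
  constructor
  · rcases le_or_gt X D with h6 | h6
    · nlinarith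
    · have h7 : τ η ε * ε * D ≤ τ η ε * ε * (2 * h p) :=
        mul_le_mul_of_nonneg_left (by linarith) (by positivity)
      nlinarith
  · have h6 : (1 + ε ^ 2) * (X + (‖a‖ * ε ^ 2 + 2 * η * ε)) - X
        = ε * (ε * X + (1 + ε ^ 2) * (‖a‖ * ε + 2 * η)) := by ring
    have h7 : ε * X ≤ ε * (2 * h p) := mul_le_mul_of_nonneg_left (by linarith) hε0.le
    have h8 : (1 + ε ^ 2) * (‖a‖ * ε + 2 * η) ≤ 2 * (‖a‖ * ε + 2 * η) :=
      mul_le_mul_of_nonneg_right (by nlinarith) (by positivity)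
    have h9 : ε * (ε * X + (1 + ε ^ 2) * (‖a‖ * ε + 2 * η)) ≤ ε * C :=
      mul_le_mul_of_nonneg_left (by linarith) hε0.le
    linarith

/-- The logarithm of the geodesic distance agrees, up to first order included, with that of
`√(h(s) h(p)) |s - p|`. -/
theorem isLittleO_log_geoDist {h : S2 → ℝ} (hsmooth : ContMDiff (𝓡 2) 𝓘(ℝ, ℝ) ∞ h)
    (hpos : ∀ s, 0 < h s) (p : S2) :
    (fun s : S2 => Real.log (geoDist h s p)
        - (logDist p s + (1 / 2 * Real.log (h s) + 1 / 2 * Real.log (h p))))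
      =o[𝓝[≠] p] fun s : S2 => ‖(s : E3) - p‖ := by
  set a : E3 := sphereGrad h p with ha
  have hp := hpos p
  have hlog := (Real.hasDerivAt_log hp.ne').isLittleO
  have key : ∀ {f : S2 → ℝ} {t : ℝ},
      (fun s : S2 => f s - (h p + t * inner ℝ a ((s : E3) - p)))
        =o[𝓝[≠] p] (fun s : S2 => ‖(s : E3) - p‖) →
      Filter.Tendsto f (𝓝[≠] p) (𝓝 (h p)) ∧
      (fun s : S2 => Real.log (f s) - (Real.log (h p) + t * inner ℝ a ((s : E3) - p) * (h p)⁻¹))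
        =o[𝓝[≠] p] fun s : S2 => ‖(s : E3) - p‖ := by
    intro f t hf
    have h1 : (fun s : S2 => t * inner ℝ a ((s : E3) - p))
        =O[𝓝[≠] p] fun s : S2 => ‖(s : E3) - p‖ := by
      refine Asymptotics.IsBigO.of_bound (|t| * ‖a‖) (Filter.Eventually.of_forall fun s => ?_)
      rw [norm_mul, norm_norm, Real.norm_eq_abs, mul_assoc]
      exact mul_le_mul_of_nonneg_left (norm_inner_le_norm _ _) (abs_nonneg t)
    have h2 : (fun s : S2 => f s - h p) =O[𝓝[≠] p] fun s : S2 => ‖(s : E3) - p‖ :=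
      (hf.isBigO.add h1).congr_left fun s => by ring
    have h3 : Filter.Tendsto f (𝓝[≠] p) (𝓝 (h p)) :=
      tendsto_sub_nhds_zero_iff.1 (h2.trans_tendsto (tendsto_norm_sub_nhds p))
    refine ⟨h3, ?_⟩
    have h4 := (hlog.comp_tendsto h3).trans_isBigO h2
    refine (h4.add (hf.const_mul_left (h p)⁻¹)).congr_left fun s => ?_
    simp only [Function.comp_apply, smul_eq_mul]
    ring
  obtain ⟨hD, h1⟩ := key (isLittleO_geoDist hsmooth hpos p)
  have h0 : (fun s : S2 => h s - (h p + 1 * inner ℝ a ((s : E3) - p)))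
      =o[𝓝[≠] p] (fun s : S2 => ‖(s : E3) - p‖) :=
    ((isLittleO_sphereGrad (contDiffAt_comp_retract hsmooth p)).mono nhdsWithin_le_nhds).congr_left
      fun s => by ring
  obtain ⟨-, h2⟩ := key h0
  refine (h1.sub (h2.const_mul_left (1 / 2))).congr' ?_ (Filter.EventuallyEq.refl _ _)
  filter_upwards [self_mem_nhdsWithin, hD.eventually (lt_mem_nhds hp)] with s hs hs2
  have hε0 : 0 < ‖(s : E3) - p‖ := norm_sub_pos_S2 hs
  have hd : geoDist h s p ≠ 0 := by
    rintro h0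
    rw [h0, zero_div] at hs2
    exact lt_irrefl _ hs2
  rw [Real.log_div hd hε0.ne', logDist]
  ring

/-! ### Stream functions and the velocity of the vortices -/

/-- Connectedness is used only to see that the sphere has no isolated points. -/
theorem connectedSpace_S2 : ConnectedSpace S2 := by
  refine isConnected_iff_connectedSpace.1 (isConnected_sphere ?_ 0 zero_le_one)
  exact Module.lt_rank_of_lt_finrank (by simp)

instance neBot_nhdsNE_S2 (s : S2) : (𝓝[≠] s).NeBot := by
  have := connectedSpace_S2
  have : Nontrivial S2 := ⟨s, -s, fun h => by
    have h1 := congrArg (fun r : S2 => inner ℝ (s : E3) (r : E3)) h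
    change inner ℝ (s : E3) (s : E3) = inner ℝ (s : E3) (-(s : E3)) at h1
    rw [inner_neg_right, inner_self_S2] at h1
    norm_num at h1⟩
  infer_instance

theorem exists_notMem_S2 (P : Finset S2) : ∃ s, s ∉ P :=
  (infinite_of_mem_nhds (retract 0) Filter.univ_mem).exists_notMem_finset P |>.imp fun _ h => h.2

open Classical in
/-- The error term in the comparison of the geodesic and the Euclidean distance to `p`; its value
at `p` is the limit. -/
def geoError (h : S2 → ℝ) (p s : S2) : ℝ :=
  if s = p then 0 else Real.log (geoDist h s p)
    - (logDist p s + (1 / 2 * Real.log (h s) + 1 / 2 * Real.log (h p)))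

/-- The estimate of the geodesic distance says that the error term does not contribute to
gradients at `p`. -/
theorem hasFDerivAt_geoError {h : S2 → ℝ} (hsmooth : ContMDiff (𝓡 2) 𝓘(ℝ, ℝ) ∞ h)
    (hpos : ∀ s, 0 < h s) (p : S2) :
    HasFDerivAt (fun x : E3 => geoError h p (retract x)) (0 : E3 →L[ℝ] ℝ) (p : E3) := by
  have h1 : geoError h p =o[𝓝 p] fun s : S2 => ‖(s : E3) - p‖ := by
    refine Asymptotics.isLittleO_iff.2 fun c hc => ?_
    have h2 := eventually_nhdsWithin_iff.1 ((isLittleO_log_geoDist hsmooth hpos p).def hc)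
    filter_upwards [h2] with s hs
    by_cases hsp : s = p
    · simp [geoError, hsp]
    · simpa only [geoError, if_neg hsp] using hs hsp
  have h2 := (hasFDerivAt_coe_retract p).isBigO_sub
  rw [retract_coe] at h2
  have h3 := (h1.comp_tendsto (tendsto_retract p)).trans_isBigO h2.norm_left
  refine HasFDerivAt.of_isLittleO (h3.congr_left fun x => ?_)
  simp [geoError]

/-- The superposition of the logarithms of the Euclidean distances to the vortices. For strengths
of sum zero it is a stream function, see `isStreamFunction_vortexStream`. -/
def vortexStream {N : ℕ} (κ : Fin N → ℝ) (σ : Config N) (s : S2) : ℝ :=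
  ∑ j, κ j / (2 * Real.pi) * logDist (σ j) s

/-- The desingularization of `vortexStream` at the `j`-th vortex, with its limit as the value at
the vortex. -/
def vortexStreamRegular {N : ℕ} (h : S2 → ℝ) (κ : Fin N → ℝ) (σ : Config N) (j : Fin N)
    (s : S2) : ℝ :=
  ∑ l ∈ Finset.univ.filter (fun l => l ≠ j), κ l / (2 * Real.pi) * logDist (σ l) s
    - κ j / (2 * Real.pi) * (1 / 2 * Real.log (h s) + (1 / 2 * Real.log (h (σ j))
      + geoError h (σ j) s))

theorem vortexStreamRegular_eq {N : ℕ} (h : S2 → ℝ) (κ : Fin N → ℝ) (σ : Config N) (j : Fin N)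
    {s : S2} (hs : s ≠ σ j) : vortexStreamRegular h κ σ j s
      = vortexStream κ σ s - κ j * (Real.log (geoDist h s (σ j)) / (2 * Real.pi)) := by
  have h1 : vortexStream κ σ s = ∑ l ∈ Finset.univ.filter (fun l => l ≠ j),
      κ l / (2 * Real.pi) * logDist (σ l) s + κ j / (2 * Real.pi) * logDist (σ j) s := by
    rw [vortexStream, Finset.filter_ne', Finset.sum_erase_add _ _ (Finset.mem_univ j)]
  rw [h1, vortexStreamRegular, geoError, if_neg hs]
  ring

theorem exists_eventually_abs_le {f : S2 → ℝ} {s : S2} (hf : ContinuousAt f s) :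
    ∃ C, ∀ᶠ r in 𝓝[≠] s, |f r| ≤ C :=
  ⟨|f s| + 1, nhdsWithin_le_nhds
    ((hf.abs.tendsto.eventually_lt_const (lt_add_one _)).mono fun _ h => h.le)⟩

theorem smoothAt_log {h : S2 → ℝ} (hsmooth : ContMDiff (𝓡 2) 𝓘(ℝ, ℝ) ∞ h)
    (hpos : ∀ s, 0 < h s) (s : S2) : SmoothAt (fun r => Real.log (h r)) s :=
  ContDiffAt.log (contDiffAt_comp_retract hsmooth s) (hpos _).ne'

/-- The gradient of the desingularized stream function at the vortex itself. -/
def regularGrad {N : ℕ} (h : S2 → ℝ) (κ : Fin N → ℝ) (σ : Config N) (j : Fin N) : E3 :=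
  ∑ l ∈ Finset.univ.filter (fun l => l ≠ j),
      (κ l / (2 * Real.pi)) • sphereGrad (logDist (σ l)) (σ j)
    - (κ j / (2 * Real.pi)) • ((1 / 2 : ℝ) • sphereGrad (fun s => Real.log (h s)) (σ j))

theorem hasFDerivAt_vortexStreamRegular {N : ℕ} {h : S2 → ℝ}
    (hsmooth : ContMDiff (𝓡 2) 𝓘(ℝ, ℝ) ∞ h) (hpos : ∀ s, 0 < h s) (κ : Fin N → ℝ)
    {σ : Config N} (hσ : Function.Injective σ) (j : Fin N) :
    HasFDerivAt (fun x : E3 => vortexStreamRegular h κ σ j (retract x))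
      (innerSL ℝ (regularGrad h κ σ j)) (σ j : E3) := by
  have h1 := HasFDerivAt.fun_sum (u := Finset.univ.filter (fun l => l ≠ j)) fun l hl =>
    (smoothAt_logDist (p := σ l) (s := σ j) fun h => (Finset.mem_filter.1 hl).2
      (hσ h.symm)).differentiableAt.hasFDerivAt.const_mul (κ l / (2 * Real.pi))
  have h2 := (smoothAt_log hsmooth hpos (σ j)).differentiableAt.hasFDerivAt.const_mul (1 / 2 : ℝ)
  have h3 := (hasFDerivAt_geoError hsmooth hpos (σ j)).const_add (1 / 2 * Real.log (h (σ j)))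
  refine (h1.sub ((h2.add h3).const_mul (κ j / (2 * Real.pi)))).congr_fderiv ?_
  ext1 v
  simp [regularGrad, inner_sphereGrad]

theorem smoothAt_vortexStream {N : ℕ} (κ : Fin N → ℝ) {σ : Config N} {s : S2}
    (hs : ∀ j, s ≠ σ j) : SmoothAt (vortexStream κ σ) s :=
  SmoothAt.sum fun j _ => (smoothAt_logDist (hs j)).const_mul _

theorem continuousAt_of_retract {f : S2 → ℝ} {s : S2}
    (hf : ContinuousAt (fun x : E3 => f (retract x)) (s : E3)) : ContinuousAt f s := by
  have h1 := hf.tendsto.comp (tendsto_coe_S2 s)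
  simpa [ContinuousAt, Function.comp_def] using h1

theorem contMDiffOn_of_smoothAt {f : S2 → ℝ} {t : Set S2} (hf : ∀ s ∈ t, SmoothAt f s) :
    ContMDiffOn (𝓡 2) 𝓘(ℝ, ℝ) ∞ f t := fun s hs =>
  (smoothAt_iff_contMDiffAt.1 (hf s hs)).contMDiffWithinAt

theorem isStreamFunction_vortexStream {N : ℕ} {h : S2 → ℝ}
    (hsmooth : ContMDiff (𝓡 2) 𝓘(ℝ, ℝ) ∞ h) (hpos : ∀ s, 0 < h s) {κ : Fin N → ℝ}
    (hsum : ∑ j, κ j = 0) {σ : Config N} (hσ : Function.Injective σ) :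
    IsStreamFunction h κ σ (vortexStream κ σ) where
  smooth := contMDiffOn_of_smoothAt fun s hs => smoothAt_vortexStream κ hs
  harmonic s hs := by
    rw [laplaceBeltrami_eq hpos]
    have h1 : sphereLaplacian (vortexStream κ σ) s = 0 := by
      refine (sphereLaplacian_sum fun j _ => (smoothAt_logDist (hs j)).const_mul _).trans ?_
      have h2 : ∀ j ∈ Finset.univ, sphereLaplacian
          (fun r => κ j / (2 * Real.pi) * logDist (σ j) r) s
            = κ j * (-(1 / 2) / (2 * Real.pi)) := fun j _ => by
        rw [sphereLaplacian_const_mul _ (smoothAt_logDist (hs j)), sphereLaplacian_logDist (hs j)]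
        ring
      rw [Finset.sum_congr rfl h2, ← Finset.sum_mul, hsum, zero_mul]
    rw [h1, mul_zero]
  singularity j := by
    have h1 : ContinuousAt (vortexStreamRegular h κ σ j) (σ j) :=
      continuousAt_of_retract
        (hasFDerivAt_vortexStreamRegular hsmooth hpos κ hσ j).continuousAt
    obtain ⟨C, hC⟩ := exists_eventually_abs_le h1
    refine ⟨C, ?_⟩
    filter_upwards [hC, self_mem_nhdsWithin] with s hs hsj
    rwa [← vortexStreamRegular_eq h κ σ j hsj]

theorem isOpen_setOf_forall_ne {N : ℕ} (σ : Config N) : IsOpen {s : S2 | ∀ j, s ≠ σ j} := by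
  have h1 : {s : S2 | ∀ j, s ≠ σ j} = ⋂ j, {σ j}ᶜ := by ext s; simp
  rw [h1]
  exact isOpen_iInter_of_finite fun j => isOpen_compl_singleton

theorem IsStreamFunction.smoothAt {N : ℕ} {h : S2 → ℝ} {κ : Fin N → ℝ} {σ : Config N}
    {ψ : S2 → ℝ} (hψ : IsStreamFunction h κ σ ψ) {s : S2} (hs : ∀ j, s ≠ σ j) : SmoothAt ψ s :=
  smoothAt_iff_contMDiffAt.2
    (hψ.smooth.contMDiffAt ((isOpen_setOf_forall_ne σ).mem_nhds hs))

theorem sphereLaplacian_eq_of_laplaceBeltrami {h : S2 → ℝ} (hpos : ∀ s, 0 < h s) {f : S2 → ℝ}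
    {s : S2} {c : ℝ} (hf : laplaceBeltrami h f s = c) : sphereLaplacian f s = h s ^ 2 * c := by
  rw [← hf, laplaceBeltrami_eq hpos, mul_inv_cancel_left₀ (pow_pos (hpos s) 2).ne']

/-- Stream functions of the same vortices differ by a constant. -/
theorem IsStreamFunction.exists_eq_add {N : ℕ} {h : S2 → ℝ} (hpos : ∀ s, 0 < h s)
    {κ : Fin N → ℝ} {σ : Config N} {ψ ψ' : S2 → ℝ} (hψ : IsStreamFunction h κ σ ψ)
    (hψ' : IsStreamFunction h κ σ ψ') : ∃ c, ∀ s, (∀ j, s ≠ σ j) → ψ s = ψ' s + c := by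
  classical
  set P : Finset S2 := Finset.univ.image σ with hP
  have hmem : ∀ {s}, s ∉ P ↔ ∀ j, s ≠ σ j := by
    intro s
    simp [hP, eq_comm]
  obtain ⟨y, hy⟩ := exists_notMem_S2 P
  refine ⟨ψ y - ψ' y, fun s hs => ?_⟩
  have h1 : ψ s - ψ' s = ψ y - ψ' y := by
    refine eq_of_sphereLaplacian_eq_zero (P := P) (f := fun r => ψ r - ψ' r) ?_ ?_ ?_
      (hmem.2 hs) hy
    · exact fun r hr => (hψ.smoothAt (hmem.1 hr)).sub (hψ'.smoothAt (hmem.1 hr))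
    · intro r hr
      rw [sphereLaplacian_sub (hψ.smoothAt (hmem.1 hr)) (hψ'.smoothAt (hmem.1 hr)),
        sphereLaplacian_eq_of_laplaceBeltrami hpos (hψ.harmonic r (hmem.1 hr)),
        sphereLaplacian_eq_of_laplaceBeltrami hpos (hψ'.harmonic r (hmem.1 hr)), sub_self]
    · intro p hp
      obtain ⟨j, -, rfl⟩ := Finset.mem_image.1 hp
      obtain ⟨C, hC⟩ := hψ.singularity j
      obtain ⟨C', hC'⟩ := hψ'.singularity j
      refine ⟨C + C', ?_⟩
      filter_upwards [hC, hC'] with r h1 h2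
      have h3 := (abs_sub _ _).trans (add_le_add h1 h2)
      rwa [sub_sub_sub_cancel_right] at h3
  linarith

/-- The velocity of the vortices: the symplectic gradient of the desingularized stream function. -/
def vortexVelocity {N : ℕ} (h : S2 → ℝ) (κ : Fin N → ℝ) (σ : Config N) (j : Fin N) : E3 :=
  rot (σ j) ((h (σ j) ^ 2)⁻¹ • regularGrad h κ σ j)

/-- The velocity of the vortices exists and does not depend on the stream function. -/
theorem isVortexVelocity_iff {N : ℕ} {h : S2 → ℝ}
    (hsmooth : ContMDiff (𝓡 2) 𝓘(ℝ, ℝ) ∞ h) (hpos : ∀ s, 0 < h s) {κ : Fin N → ℝ}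
    (hsum : ∑ j, κ j = 0) {σ : Config N} (hσ : Function.Injective σ) (X : Fin N → E3) :
    IsVortexVelocity h κ σ X ↔ X = vortexVelocity h κ σ := by
  have hψ₀ := isStreamFunction_vortexStream hsmooth hpos hsum hσ
  have hd := hasFDerivAt_vortexStreamRegular hsmooth hpos κ hσ
  have hcont : ∀ j, ContinuousAt (vortexStreamRegular h κ σ j) (σ j) := fun j =>
    continuousAt_of_retract (hd j).continuousAt
  have hgrad : ∀ j, sphereGrad (vortexStreamRegular h κ σ j) (σ j) = regularGrad h κ σ j :=
    fun j => sphereGrad_eq (hd j) fun v => rfl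
  constructor
  · rintro ⟨ψ, hψ, hX⟩
    obtain ⟨c, hc⟩ := hψ.exists_eq_add hpos hψ₀
    funext j
    obtain ⟨ρ, ⟨hρ, hlim⟩, hρd, hXj⟩ := hX j
    -- two desingularizations at the same vortex differ by a constant, at the vortex too
    have h1 : ρ =ᶠ[𝓝[≠] (σ j)] fun s => vortexStreamRegular h κ σ j s + c := by
      have h2 : ∀ᶠ s in 𝓝[≠] (σ j), ∀ l, s ≠ σ l := by
        refine Filter.eventually_all.2 fun l => ?_
        by_cases hl : l = j
        · subst hl; exact self_mem_nhdsWithin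
        · exact nhdsWithin_le_nhds (isOpen_ne.mem_nhds fun h => hl (hσ h.symm))
      filter_upwards [h2] with s hs
      rw [hρ s (hs j), hc s hs, vortexStreamRegular_eq h κ σ j (hs j)]
      ring
    have h2 : ρ (σ j) = vortexStreamRegular h κ σ j (σ j) + c :=
      tendsto_nhds_unique (hlim.congr' h1)
        (((hcont j).tendsto.add_const c).mono_left nhdsWithin_le_nhds)
    have h3 : ρ =ᶠ[𝓝 (σ j)] fun s => vortexStreamRegular h κ σ j s + c := by
      filter_upwards [eventually_nhdsWithin_iff.1 h1] with s hs
      by_cases hsj : s = σ j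
      · rw [hsj, h2]
      · exact hs hsj
    rw [hXj, sgrad, grad, sphereGrad_congr h3,
      sphereGrad_add (hd j).differentiableAt (smoothAt_const c (σ j)).differentiableAt,
      sphereGrad_const, add_zero, hgrad, vortexVelocity]
  · rintro rfl
    refine ⟨vortexStream κ σ, hψ₀, fun j => ⟨vortexStreamRegular h κ σ j,
      ⟨fun s hs => vortexStreamRegular_eq h κ σ j hs, (hcont j).tendsto.mono_left
        nhdsWithin_le_nhds⟩, (hd j).differentiableAt, ?_⟩⟩
    rw [sgrad, grad, hgrad, vortexVelocity]

/-! ### The Hamiltonian -/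

theorem contDiffAt_sphereHamiltonian {N : ℕ} {h : S2 → ℝ}
    (hsmooth : ContMDiff (𝓡 2) 𝓘(ℝ, ℝ) ∞ h) (hpos : ∀ s, 0 < h s) (κ : Fin N → ℝ)
    {σ : Config N} (hσ : Function.Injective σ) :
    ContDiffAt ℝ ∞ (fun x => sphereHamiltonian h κ (retractAll x)) (incl σ) := by
  refine contDiffAt_const.mul (ContDiffAt.sum fun j _ => ContDiffAt.sum fun l hl =>
    contDiffAt_const.mul (ContDiffAt.log ?_ ?_))
  · exact ((contDiffAt_comp_retractAll hsmooth σ j).mul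
      (contDiffAt_comp_retractAll hsmooth σ l)).mul
      (((contDiffAt_coe_retractAll σ j).sub (contDiffAt_coe_retractAll σ l)).norm_sq ℝ)
  · have h1 : σ j ≠ σ l := fun h => (Finset.mem_filter.1 hl).2 (hσ h.symm)
    have h2 := mul_pos (mul_pos (hpos (σ j)) (hpos (σ l))) (pow_pos (norm_sub_pos_S2 h1) 2)
    simpa [retractAll, incl] using h2.ne'

theorem retractAll_incl {N : ℕ} (σ : Config N) : retractAll (incl σ) = σ := by
  funext j; simp [retractAll, incl]

theorem continuousAt_retractAll_apply {N : ℕ} (σ : Config N) (j : Fin N) :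
    ContinuousAt (fun x : Fin N → E3 => retractAll x j) (incl σ) :=
  ContinuousAt.comp (g := retract) (f := fun x : Fin N → E3 => x j)
    (continuousAt_retract (coe_S2_ne_zero (σ j))) (continuous_apply j).continuousAt

/-- The differential of the logarithm of the distance of two of the points. -/
theorem hasFDerivAt_logDist_pair {N : ℕ} {σ : Config N} {j l : Fin N} (hjl : σ j ≠ σ l) :
    HasFDerivAt (fun x : Fin N → E3 => logDist (retractAll x l) (retractAll x j))
      ((innerSL ℝ (sphereGrad (logDist (σ l)) (σ j))).comp (ContinuousLinearMap.proj (R := ℝ) j)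
        + (innerSL ℝ (sphereGrad (logDist (σ j)) (σ l))).comp
          (ContinuousLinearMap.proj (R := ℝ) l)) (incl σ) := by
  have h0 : ∀ i, HasFDerivAt (fun x : Fin N → E3 => (retractAll x i : E3))
      ((tangentProj (σ i)).comp (ContinuousLinearMap.proj (R := ℝ) (φ := fun _ => E3) i))
      (incl σ) := fun i =>
    HasFDerivAt.comp (g := fun x : E3 => (retract x : E3)) (incl σ)
      (hasFDerivAt_coe_retract (σ i)) (hasFDerivAt_apply i _)
  have h1 := inner_lt_one_S2 hjl
  have h2 := (((((h0 j).inner ℝ (h0 l)).const_mul 2).const_sub 2).log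
    (by rw [retractAll_incl]; linarith)).const_mul (1 / 2)
  refine (h2.congr_fderiv ?_).congr_of_eventuallyEq
    (Filter.Eventually.of_forall fun x => logDist_eq _ _)
  ext1 η
  rw [sphereGrad_logDist hjl, sphereGrad_logDist hjl.symm, real_inner_comm (σ j : E3) (σ l : E3)]
  simp [retractAll_incl, tangentProj_apply, inner_smul_left, inner_smul_right, inner_sub_left,
    inner_sub_right]
  have h3 : 1 - inner ℝ (σ j : E3) (σ l : E3) ≠ 0 := by linarith
  have h4 : 2 - 2 * inner ℝ (σ j : E3) (σ l : E3) ≠ 0 := by linarith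
  rw [real_inner_comm (σ l : E3) (η j)]
  field_simp
  ring

theorem sum_filter_ne_comm {N : ℕ} (F : Fin N → Fin N → ℝ) :
    ∑ j, ∑ l ∈ Finset.univ.filter (fun l => l ≠ j), F j l
      = ∑ j, ∑ l ∈ Finset.univ.filter (fun l => l ≠ j), F l j :=
  Finset.sum_comm' fun j l => by simp [ne_comm]

theorem sum_filter_ne_eq_neg {N : ℕ} {κ : Fin N → ℝ} (hsum : ∑ j, κ j = 0) (j : Fin N) :
    ∑ l ∈ Finset.univ.filter (fun l => l ≠ j), κ l = -κ j := by
  have h1 := Finset.sum_erase_add Finset.univ κ (Finset.mem_univ j)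
  rw [Finset.filter_ne']
  linarith

theorem log_sphereHamiltonian_term {h : S2 → ℝ} (hpos : ∀ s, 0 < h s) {s p : S2} (hsp : s ≠ p) :
    Real.log (h s * h p * ‖(s : E3) - p‖ ^ 2)
      = Real.log (h s) + Real.log (h p) + 2 * logDist p s := by
  rw [Real.log_mul (mul_pos (hpos s) (hpos p)).ne' (pow_pos (norm_sub_pos_S2 hsp) 2).ne',
    Real.log_mul (hpos s).ne' (hpos p).ne', Real.log_pow, logDist]
  push_cast
  ring

/-- Both the pair terms `log |s_j - s_l|` and, through `∑_{l ≠ j} κ_l = -κ_j`, the terms `log h`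
of the Hamiltonian match those of the desingularized stream functions. -/
theorem differential_sphereHamiltonian {N : ℕ} {h : S2 → ℝ}
    (hsmooth : ContMDiff (𝓡 2) 𝓘(ℝ, ℝ) ∞ h) (hpos : ∀ s, 0 < h s) {κ : Fin N → ℝ}
    (hsum : ∑ j, κ j = 0) {σ : Config N} (hσ : Function.Injective σ) (η : Fin N → E3) :
    differential (fun τ => sphereHamiltonian h κ τ / (2 * Real.pi)) σ η
      = ∑ j, κ j * inner ℝ (regularGrad h κ σ j) (η j) := by
  have hne : ∀ j, ∀ l ∈ Finset.univ.filter (fun l => l ≠ j), σ j ≠ σ l := fun j l hl h =>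
    (Finset.mem_filter.1 hl).2 (hσ h.symm)
  have hk : ∀ j, HasFDerivAt (fun x : Fin N → E3 => Real.log (h (retractAll x j)))
      ((innerSL ℝ (sphereGrad (fun s => Real.log (h s)) (σ j))).comp
        (ContinuousLinearMap.proj (R := ℝ) j)) (incl σ) := fun j => by
    refine (hasFDerivAt_comp_apply (f := fun s => Real.log (h s)) σ j
      (smoothAt_log hsmooth hpos (σ j)).differentiableAt).congr_fderiv ?_
    ext1 v
    simp [inner_sphereGrad]
  have h1 := (HasFDerivAt.fun_sum (u := Finset.univ) fun j _ =>
    HasFDerivAt.fun_sum (u := Finset.univ.filter (fun l => l ≠ j)) fun l hl =>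
      (((hk j).add (hk l)).add ((hasFDerivAt_logDist_pair (hne j l hl)).const_mul 2)).const_mul
        (κ j * κ l)).const_mul (1 / 4 : ℝ) |>.mul_const (2 * Real.pi)⁻¹
  have h2 : (fun x : Fin N → E3 => sphereHamiltonian h κ (retractAll x) / (2 * Real.pi))
      =ᶠ[𝓝 (incl σ)] fun x => (1 / 4 * ∑ j, ∑ l ∈ Finset.univ.filter (fun l => l ≠ j),
        κ j * κ l * (Real.log (h (retractAll x j)) + Real.log (h (retractAll x l))
          + 2 * logDist (retractAll x l) (retractAll x j))) * (2 * Real.pi)⁻¹ := by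
    have h3 : ∀ᶠ x in 𝓝 (incl σ), ∀ j, ∀ l ∈ Finset.univ.filter (fun l => l ≠ j),
        retractAll x j ≠ retractAll x l := by
      refine Filter.eventually_all.2 fun j => (Filter.eventually_all_finset _).2 fun l hl => ?_
      refine ((continuousAt_retractAll_apply σ j).prodMk
        (continuousAt_retractAll_apply σ l)).tendsto.eventually
        (isClosed_diagonal.isOpen_compl.mem_nhds ?_)
      simpa [retractAll_incl] using hne j l hl
    filter_upwards [h3] with x hx
    rw [sphereHamiltonian, div_eq_mul_inv]
    congr 2
    refine Finset.sum_congr rfl fun j _ => Finset.sum_congr rfl fun l hl => ?_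
    rw [log_sphereHamiltonian_term hpos (hx j l hl)]
  rw [differential, (h1.congr_of_eventuallyEq h2).fderiv]
  set k : Fin N → ℝ := fun j =>
    inner ℝ (sphereGrad (fun s => Real.log (h s)) (σ j)) (η j) with hkdef
  set g : Fin N → Fin N → ℝ := fun j l => inner ℝ (sphereGrad (logDist (σ l)) (σ j)) (η j) with hg
  have h4 : ∀ j, inner ℝ (regularGrad h κ σ j) (η j) = (2 * Real.pi)⁻¹ *
      (∑ l ∈ Finset.univ.filter (fun l => l ≠ j), κ l * g j l - 1 / 2 * κ j * k j) := by
    intro j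
    rw [regularGrad, inner_sub_left, sum_inner, mul_sub, Finset.mul_sum]
    simp only [inner_smul_left, hkdef, hg, conj_trivial]
    congr 1
    · exact Finset.sum_congr rfl fun l _ => by ring
    · ring
  have h5 : ∑ j, ∑ l ∈ Finset.univ.filter (fun l => l ≠ j),
      κ j * κ l * (k j + k l + 2 * (g j l + g l j))
        = 2 * ∑ j, ∑ l ∈ Finset.univ.filter (fun l => l ≠ j), κ j * κ l * (k j + 2 * g j l) := by
    have h6 := sum_filter_ne_comm fun j l => κ j * κ l * (k l + 2 * g l j)
    rw [two_mul]
    nth_rewrite 2 [show (∑ j, ∑ l ∈ Finset.univ.filter (fun l => l ≠ j),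
      κ j * κ l * (k j + 2 * g j l)) = ∑ j, ∑ l ∈ Finset.univ.filter (fun l => l ≠ j),
      κ l * κ j * (k j + 2 * g j l) by simp only [mul_comm (κ _) (κ _)]]
    rw [← h6, ← Finset.sum_add_distrib]
    refine Finset.sum_congr rfl fun j _ => ?_
    rw [← Finset.sum_add_distrib]
    exact Finset.sum_congr rfl fun l _ => by ring
  have h6 : ∀ j, ∑ l ∈ Finset.univ.filter (fun l => l ≠ j), κ j * κ l * (k j + 2 * g j l)
      = 2 * (κ j * (∑ l ∈ Finset.univ.filter (fun l => l ≠ j), κ l * g j l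
        - 1 / 2 * κ j * k j)) := by
    intro j
    have h7 : ∀ l, κ j * κ l * (k j + 2 * g j l)
        = κ l * (κ j * k j) + 2 * κ j * (κ l * g j l) := fun l => by ring
    rw [Finset.sum_congr rfl fun l _ => h7 l, Finset.sum_add_distrib, ← Finset.sum_mul,
      sum_filter_ne_eq_neg hsum, ← Finset.mul_sum]
    ring
  simp only [h4]
  simp only [smul_apply, sum_apply, add_apply,
    ContinuousLinearMap.comp_apply, ContinuousLinearMap.proj_apply, smul_eq_mul,
    innerSL_apply_apply]
  change _ * (1 / 4 * ∑ j, ∑ l ∈ Finset.univ.filter (fun l => l ≠ j),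
      κ j * κ l * (k j + k l + 2 * (g j l + g l j))) = _
  rw [h5, Finset.sum_congr rfl fun j _ => h6 j, ← Finset.mul_sum, Finset.mul_sum, Finset.mul_sum,
    Finset.mul_sum, Finset.mul_sum]
  exact Finset.sum_congr rfl fun j _ => by ring

/-- On collision-free configurations the velocity of the vortices is the Hamiltonian vector. -/
theorem isHamiltonianVector_iff {N : ℕ} {h : S2 → ℝ}
    (hsmooth : ContMDiff (𝓡 2) 𝓘(ℝ, ℝ) ∞ h) (hpos : ∀ s, 0 < h s) {κ : Fin N → ℝ}
    (hκ : ∀ j, κ j ≠ 0) (hsum : ∑ j, κ j = 0) {σ : Config N} (hσ : Function.Injective σ)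
    (X : Fin N → E3) :
    IsHamiltonianVector (vortexForm h κ) (fun τ => sphereHamiltonian h κ τ / (2 * Real.pi)) σ X
      ↔ X = vortexVelocity h κ σ := by
  have hΩ := isSymplecticForm_vortexForm hκ hsmooth hpos
  have htan : IsTangentVector σ (vortexVelocity h κ σ) := fun j => isTangent_rot _ _
  have hV : ∀ η, IsTangentVector σ η → vortexForm h κ σ (vortexVelocity h κ σ) η =
      differential (fun τ => sphereHamiltonian h κ τ / (2 * Real.pi)) σ η := by
    intro η hη
    rw [differential_sphereHamiltonian hsmooth hpos hsum hσ, vortexForm]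
    refine Finset.sum_congr rfl fun j _ => ?_
    rw [vortexVelocity, omega_rot _ _ _ (hη j), inner_smul_left, conj_trivial,
      mul_inv_cancel_left₀ (pow_pos (hpos (σ j)) 2).ne']
  constructor
  · rintro ⟨hX, hXV⟩
    have h1 : X + (-1 : ℝ) • vortexVelocity h κ σ = 0 := by
      refine hΩ.nondegenerate σ _ (fun j => ?_) fun η hη => ?_
      · have h2 := hX j
        have h3 := htan j
        rw [IsTangent] at h2 h3
        simp [IsTangent, inner_add_right, h2, h3]
      · rw [hΩ.add_left, hΩ.smul_left, hXV η hη, hV η hη]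
        ring
    rw [neg_one_smul, ← sub_eq_add_neg] at h1
    exact sub_eq_zero.1 h1
  · rintro rfl
    exact ⟨htan, hV⟩

/-! ### The Green function and the Robin function -/

theorem IsGreenFunction.smoothAt {h : S2 → ℝ} {G : S2 → S2 → ℝ} (hG : IsGreenFunction h G)
    {s r : S2} (hsr : s ≠ r) : SmoothAt (fun q => G q r) s := by
  have hopen : IsOpen {p : S2 × S2 | p.1 ≠ p.2} := isClosed_diagonal.isOpen_compl
  have h1 : ContMDiffAt ((𝓡 2).prod (𝓡 2)) 𝓘(ℝ, ℝ) ∞ (fun p : S2 × S2 => G p.1 p.2) (s, r) :=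
    hG.smooth.contMDiffAt (hopen.mem_nhds hsr)
  have h2 : ContMDiffAt (𝓡 2) ((𝓡 2).prod (𝓡 2)) ∞ (fun q : S2 => (q, r)) s :=
    contMDiffAt_id.prodMk contMDiffAt_const
  exact smoothAt_iff_contMDiffAt.2 (ContMDiffAt.comp s h1 h2)

/-- The Green function without its singularity, which is measured by the Euclidean distance.
Values on the diagonal are irrelevant. -/
def greenRegular (G : S2 → S2 → ℝ) (s r : S2) : ℝ := G s r - 1 / (2 * Real.pi) * logDist r s

theorem greenRegular_comm {h : S2 → ℝ} {G : S2 → S2 → ℝ} (hG : IsGreenFunction h G) (s r : S2) :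
    greenRegular G s r = greenRegular G r s := by
  rw [greenRegular, greenRegular, hG.symm, logDist_comm]

theorem IsGreenFunction.smoothAt_greenRegular {h : S2 → ℝ} {G : S2 → S2 → ℝ}
    (hG : IsGreenFunction h G) {s r : S2} (hsr : s ≠ r) :
    SmoothAt (fun q => greenRegular G q r) s :=
  (hG.smoothAt hsr).sub ((smoothAt_logDist hsr).const_mul _)

theorem IsGreenFunction.sphereLaplacian_greenRegular {h : S2 → ℝ} (hpos : ∀ s, 0 < h s)
    {G : S2 → S2 → ℝ} (hG : IsGreenFunction h G) {s r : S2} (hsr : s ≠ r) :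
    sphereLaplacian (fun q => greenRegular G q r) s
      = h s ^ 2 * -(1 / totalArea h) + 1 / (2 * Real.pi) * (1 / 2) := by
  have h1 := sphereLaplacian_sub (hG.smoothAt hsr)
    ((smoothAt_logDist hsr).const_mul (1 / (2 * Real.pi)))
  rw [sphereLaplacian_eq_of_laplaceBeltrami hpos (hG.laplacian r s hsr),
    sphereLaplacian_const_mul _ (smoothAt_logDist hsr), sphereLaplacian_logDist hsr] at h1
  refine Eq.trans h1 ?_
  ring

theorem greenRegular_eq {h : S2 → ℝ} (G : S2 → S2 → ℝ) {s r : S2} (hsr : s ≠ r) :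
    greenRegular G s r = G s r - Real.log (geoDist h s r) / (2 * Real.pi)
      + 1 / (2 * Real.pi) * (1 / 2 * Real.log (h s) + 1 / 2 * Real.log (h r)
        + geoError h r s) := by
  rw [greenRegular, geoError, if_neg hsr]
  ring

/-- The two regularizations of the Green function, by the geodesic and by the Euclidean distance,
differ by a continuous function. -/
theorem continuousAt_comparison {h : S2 → ℝ} (hsmooth : ContMDiff (𝓡 2) 𝓘(ℝ, ℝ) ∞ h)
    (hpos : ∀ s, 0 < h s) (r : S2) :
    ContinuousAt (fun s => 1 / (2 * Real.pi) * (1 / 2 * Real.log (h s) + 1 / 2 * Real.log (h r)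
        + geoError h r s)) r :=
  continuousAt_const.mul (((continuousAt_const.mul (smoothAt_log hsmooth hpos r).continuousAt).add
    continuousAt_const).add
      (continuousAt_of_retract (hasFDerivAt_geoError hsmooth hpos r).continuousAt))

theorem IsGreenFunction.eventually_abs_greenRegular_le {h : S2 → ℝ}
    (hsmooth : ContMDiff (𝓡 2) 𝓘(ℝ, ℝ) ∞ h) (hpos : ∀ s, 0 < h s) {G : S2 → S2 → ℝ}
    (hG : IsGreenFunction h G) (p r : S2) : ∃ C, ∀ᶠ s in 𝓝[≠] p, |greenRegular G s r| ≤ C := by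
  rcases eq_or_ne p r with rfl | hpr
  · obtain ⟨C, hC⟩ := hG.singularity p
    obtain ⟨C', hC'⟩ :=
      exists_eventually_abs_le (continuousAt_comparison hsmooth hpos p)
    refine ⟨C + C', ?_⟩
    filter_upwards [self_mem_nhdsWithin, hC'] with s hs h1
    rw [greenRegular_eq (h := h) G hs]
    exact (abs_add_le _ _).trans (add_le_add (hC s hs) h1)
  · exact exists_eventually_abs_le (hG.smoothAt_greenRegular hpr).continuousAt

/-- The regular parts with poles `r` and `r'` have the same Laplacian and are bounded near both
poles, hence differ by a constant. -/
theorem IsGreenFunction.greenRegular_sub_eq {h : S2 → ℝ}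
    (hsmooth : ContMDiff (𝓡 2) 𝓘(ℝ, ℝ) ∞ h) (hpos : ∀ s, 0 < h s) {G : S2 → S2 → ℝ}
    (hG : IsGreenFunction h G) {r r' s q : S2} (hsr : s ≠ r) (hsr' : s ≠ r') (hqr : q ≠ r)
    (hqr' : q ≠ r') : greenRegular G s r - greenRegular G s r'
      = greenRegular G q r - greenRegular G q r' := by
  classical
  have hmem : ∀ {t : S2}, t ∉ ({r, r'} : Finset S2) ↔ t ≠ r ∧ t ≠ r' := by simp
  refine eq_of_sphereLaplacian_eq_zero (P := {r, r'})
    (f := fun t => greenRegular G t r - greenRegular G t r') (fun t ht => ?_) (fun t ht => ?_)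
    (fun p _ => ?_) (hmem.2 ⟨hsr, hsr'⟩) (hmem.2 ⟨hqr, hqr'⟩)
  · obtain ⟨h1, h2⟩ := hmem.1 ht
    exact (hG.smoothAt_greenRegular h1).sub (hG.smoothAt_greenRegular h2)
  · obtain ⟨h1, h2⟩ := hmem.1 ht
    rw [sphereLaplacian_sub (hG.smoothAt_greenRegular h1) (hG.smoothAt_greenRegular h2),
      hG.sphereLaplacian_greenRegular hpos h1, hG.sphereLaplacian_greenRegular hpos h2, sub_self]
  · obtain ⟨C, hC⟩ := hG.eventually_abs_greenRegular_le hsmooth hpos p r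
    obtain ⟨C', hC'⟩ := hG.eventually_abs_greenRegular_le hsmooth hpos p r'
    refine ⟨C + C', ?_⟩
    filter_upwards [hC, hC'] with t h1 h2
    exact (abs_sub _ _).trans (add_le_add h1 h2)

/-- Near the pole `s` the regular part differs by a constant from the one with pole `r`, which is
smooth at `s`. -/
theorem IsGreenFunction.tendsto_greenRegular {h : S2 → ℝ}
    (hsmooth : ContMDiff (𝓡 2) 𝓘(ℝ, ℝ) ∞ h) (hpos : ∀ s, 0 < h s) {G : S2 → S2 → ℝ}
    (hG : IsGreenFunction h G) {s r q : S2} (hsr : s ≠ r) (hqs : q ≠ s) (hqr : q ≠ r) :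
    Filter.Tendsto (fun t => greenRegular G t s) (𝓝[≠] s)
      (𝓝 (greenRegular G s r + (greenRegular G q s - greenRegular G q r))) := by
  have h1 := (hG.smoothAt_greenRegular hsr).continuousAt.tendsto.add_const
    (greenRegular G q s - greenRegular G q r)
  refine (h1.mono_left (nhdsWithin_le_nhds (s := {s}ᶜ))).congr' ?_
  filter_upwards [self_mem_nhdsWithin, nhdsWithin_le_nhds (isOpen_ne.mem_nhds hsr)] with t h2 h3
  have h4 := hG.greenRegular_sub_eq hsmooth hpos h2 h3 hqs hqr
  linarith

/-- Off the diagonal the Green function is the logarithm of the Euclidean distance, up to a sum of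
functions of one variable; these are given by the limits of its regular part at the diagonal. -/
theorem IsGreenFunction.exists_greenRegular_eq {h : S2 → ℝ}
    (hsmooth : ContMDiff (𝓡 2) 𝓘(ℝ, ℝ) ∞ h) (hpos : ∀ s, 0 < h s) {G : S2 → S2 → ℝ}
    (hG : IsGreenFunction h G) : ∃ L : S2 → ℝ,
      (∀ s, Filter.Tendsto (fun t => greenRegular G t s) (𝓝[≠] s) (𝓝 (L s))) ∧
      ∀ s r, s ≠ r → greenRegular G s r = 1 / 2 * (L s + L r) := by
  classical
  have hex : ∀ s, ∃ L, Filter.Tendsto (fun t => greenRegular G t s) (𝓝[≠] s) (𝓝 L) := by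
    intro s
    obtain ⟨r, hr⟩ := exists_notMem_S2 {s}
    obtain ⟨q, hq⟩ := exists_notMem_S2 {s, r}
    simp only [Finset.mem_singleton, Finset.mem_insert, not_or] at hr hq
    exact ⟨_, hG.tendsto_greenRegular hsmooth hpos (Ne.symm hr) hq.1 hq.2⟩
  choose L hL using hex
  refine ⟨L, hL, fun s r hsr => ?_⟩
  obtain ⟨q, hq⟩ := exists_notMem_S2 {s, r}
  simp only [Finset.mem_singleton, Finset.mem_insert, not_or] at hq
  have h1 := tendsto_nhds_unique (hL s) (hG.tendsto_greenRegular hsmooth hpos hsr hq.1 hq.2)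
  have h2 := tendsto_nhds_unique (hL r) (hG.tendsto_greenRegular hsmooth hpos hsr.symm hq.2 hq.1)
  rw [greenRegular_comm hG r s] at h2
  linarith

/-- The background vorticities `-1 / Area` of the Green functions cancel as `∑ κ_j = 0`. -/
theorem IsGreenFunction.isStreamFunction {N : ℕ} {h : S2 → ℝ} (hpos : ∀ s, 0 < h s)
    {G : S2 → S2 → ℝ} (hG : IsGreenFunction h G) {κ : Fin N → ℝ} (hsum : ∑ j, κ j = 0)
    {σ : Config N} (hσ : Function.Injective σ) :
    IsStreamFunction h κ σ (fun s => ∑ j, κ j * G s (σ j)) where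
  smooth := contMDiffOn_of_smoothAt fun s hs =>
    SmoothAt.sum fun j _ => (hG.smoothAt (hs j)).const_mul _
  harmonic s hs := by
    rw [laplaceBeltrami_eq hpos, sphereLaplacian_sum fun j _ => (hG.smoothAt (hs j)).const_mul _]
    have h2 : ∀ j ∈ Finset.univ, sphereLaplacian (fun r => κ j * G r (σ j)) s
        = κ j * (h s ^ 2 * -(1 / totalArea h)) := fun j _ => by
      rw [sphereLaplacian_const_mul _ (hG.smoothAt (hs j)),
        sphereLaplacian_eq_of_laplaceBeltrami hpos (hG.laplacian (σ j) s (hs j))]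
    rw [Finset.sum_congr rfl h2, ← Finset.sum_mul, hsum, zero_mul, mul_zero]
  singularity j := by
    obtain ⟨C, hC⟩ := hG.singularity (σ j)
    have h1 : ContinuousAt (fun s => ∑ l ∈ Finset.univ.erase j, κ l * G s (σ l)) (σ j) :=
      (SmoothAt.sum fun l hl => (hG.smoothAt fun h =>
        Finset.ne_of_mem_erase hl (hσ h.symm)).const_mul _).continuousAt
    obtain ⟨C', hC'⟩ := exists_eventually_abs_le h1
    refine ⟨C' + |κ j| * C, ?_⟩
    filter_upwards [hC', self_mem_nhdsWithin] with s hs hsj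
    rw [← Finset.sum_erase_add _ _ (Finset.mem_univ j), add_sub_assoc, ← mul_sub]
    refine (abs_add_le _ _).trans (add_le_add hs ?_)
    rw [abs_mul]
    exact mul_le_mul_of_nonneg_left (hC s hsj) (abs_nonneg (κ j))

theorem two_mul_sum_filter_lt {N : ℕ} {F : Fin N → Fin N → ℝ} (hF : ∀ i j, F i j = F j i) :
    2 * ∑ j, ∑ i ∈ Finset.univ.filter (fun i => i < j), F i j
      = ∑ j, ∑ i ∈ Finset.univ.filter (fun i => i ≠ j), F j i := by
  have h1 : ∑ j, ∑ i ∈ Finset.univ.filter (fun i => j < i), F j i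
      = ∑ j, ∑ i ∈ Finset.univ.filter (fun i => i < j), F i j :=
    Finset.sum_comm' fun i j => by simp
  have h2 : ∀ j, ∑ i ∈ Finset.univ.filter (fun i => i ≠ j), F j i
      = ∑ i ∈ Finset.univ.filter (fun i => i < j), F i j
        + ∑ i ∈ Finset.univ.filter (fun i => j < i), F j i := by
    intro j
    rw [Finset.sum_congr rfl fun i _ => hF i j, ← Finset.sum_union]
    · refine Finset.sum_congr ?_ fun _ _ => rfl
      ext i
      simp [lt_or_lt_iff_ne]
    · refine Finset.disjoint_filter.2 fun i _ h3 h4 => lt_asymm h3 h4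
  rw [Finset.sum_congr rfl fun j _ => h2 j, Finset.sum_add_distrib, h1, two_mul]

/-- Functions of one point contribute to the pair energy of a neutral configuration only through
the squares of the strengths. -/
theorem sum_filter_ne_mul_add {N : ℕ} {κ : Fin N → ℝ} (hsum : ∑ j, κ j = 0) (u : Fin N → ℝ) :
    ∑ j, ∑ l ∈ Finset.univ.filter (fun l => l ≠ j), κ j * κ l * (u j + u l)
      = -2 * ∑ j, κ j ^ 2 * u j := by
  have h1 : ∑ j, ∑ l ∈ Finset.univ.filter (fun l => l ≠ j), κ j * κ l * u j
      = -∑ j, κ j ^ 2 * u j := by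
    rw [← Finset.sum_neg_distrib]
    refine Finset.sum_congr rfl fun j _ => ?_
    have h2 : ∀ l, κ j * κ l * u j = κ l * (κ j * u j) := fun l => by ring
    rw [Finset.sum_congr rfl fun l _ => h2 l, ← Finset.sum_mul, sum_filter_ne_eq_neg hsum]
    ring
  have h2 : ∑ j, ∑ l ∈ Finset.univ.filter (fun l => l ≠ j), κ j * κ l * u l
      = -∑ j, κ j ^ 2 * u j := by
    rw [sum_filter_ne_comm fun j l => κ j * κ l * u l, ← h1]
    exact Finset.sum_congr rfl fun j _ => Finset.sum_congr rfl fun l _ => by ring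
  simp only [mul_add, Finset.sum_add_distrib, h1, h2]
  ring

/-- The collective Hamiltonian, with the Robin function `L - log h / 2π`: the contributions of
`L` to the pair energy and to the self energy cancel. -/
theorem collectiveHamiltonian_eq {N : ℕ} {h : S2 → ℝ} (hpos : ∀ s, 0 < h s) {κ : Fin N → ℝ}
    (hsum : ∑ j, κ j = 0) {G : S2 → S2 → ℝ} (hG : IsGreenFunction h G) {L : S2 → ℝ}
    (hL : ∀ s r, s ≠ r → greenRegular G s r = 1 / 2 * (L s + L r)) {σ : Config N}
    (hσ : Function.Injective σ) :
    collectiveHamiltonian κ G (fun s => L s - 1 / (2 * Real.pi) * Real.log (h s)) σ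
      = sphereHamiltonian h κ σ / (2 * Real.pi) := by
  set S : ℝ := ∑ j, ∑ l ∈ Finset.univ.filter (fun l => l ≠ j),
    κ j * κ l * logDist (σ l) (σ j) with hS
  have hne : ∀ j, ∀ l ∈ Finset.univ.filter (fun l => l ≠ j), σ j ≠ σ l := fun j l hl h =>
    (Finset.mem_filter.1 hl).2 (hσ h.symm)
  have h1 : ∑ j, ∑ i ∈ Finset.univ.filter (fun i => i < j), κ i * κ j * G (σ i) (σ j)
      = 1 / 2 * (1 / (2 * Real.pi) * S + 1 / 2 * (-2 * ∑ j, κ j ^ 2 * L (σ j))) := by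
    rw [← sum_filter_ne_mul_add hsum (fun j => L (σ j)), hS, Finset.mul_sum, Finset.mul_sum,
      ← Finset.sum_add_distrib]
    have h2 := two_mul_sum_filter_lt (F := fun i j => κ i * κ j * G (σ i) (σ j))
      fun i j => by rw [hG.symm, mul_comm (κ i)]
    rw [eq_div_of_mul_eq two_ne_zero ((mul_comm _ _).trans h2), div_eq_inv_mul, ← one_div]
    congr 1
    refine Finset.sum_congr rfl fun j _ => ?_
    rw [Finset.mul_sum, Finset.mul_sum, ← Finset.sum_add_distrib]
    refine Finset.sum_congr rfl fun l hl => ?_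
    have h3 := hL (σ j) (σ l) (hne j l hl)
    rw [greenRegular] at h3
    rw [eq_add_of_sub_eq h3]
    ring
  have h2 : sphereHamiltonian h κ σ
      = 1 / 4 * (-2 * ∑ j, κ j ^ 2 * Real.log (h (σ j)) + 2 * S) := by
    rw [← sum_filter_ne_mul_add hsum (fun j => Real.log (h (σ j))), hS, Finset.mul_sum,
      ← Finset.sum_add_distrib, sphereHamiltonian]
    congr 1
    refine Finset.sum_congr rfl fun j _ => ?_
    rw [Finset.mul_sum, ← Finset.sum_add_distrib]
    refine Finset.sum_congr rfl fun l hl => ?_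
    rw [log_sphereHamiltonian_term hpos (hne j l hl)]
    ring
  have h3 : ∑ i, 1 / 2 * κ i ^ 2 * (L (σ i) - 1 / (2 * Real.pi) * Real.log (h (σ i)))
      = 1 / 2 * ∑ j, κ j ^ 2 * L (σ j)
        - 1 / 2 * (1 / (2 * Real.pi)) * ∑ j, κ j ^ 2 * Real.log (h (σ j)) := by
    rw [Finset.mul_sum, Finset.mul_sum, ← Finset.sum_sub_distrib]
    exact Finset.sum_congr rfl fun j _ => by ring
  rw [collectiveHamiltonian, h1, h2, h3]
  ring

/-- The limits `L` of the regular part of the Green function give the Robin function. -/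
theorem isRobinValue_of_tendsto {h : S2 → ℝ} (hsmooth : ContMDiff (𝓡 2) 𝓘(ℝ, ℝ) ∞ h)
    (hpos : ∀ s, 0 < h s) {G : S2 → S2 → ℝ} {s : S2} {L : ℝ}
    (hL : Filter.Tendsto (fun t => greenRegular G t s) (𝓝[≠] s) (𝓝 L)) :
    IsRobinValue h G s (L - 1 / (2 * Real.pi) * Real.log (h s)) := by
  have h1 := hL.sub
    ((continuousAt_comparison hsmooth hpos s).tendsto.mono_left (nhdsWithin_le_nhds (s := {s}ᶜ)))
  have h2 : 1 / (2 * Real.pi) * (1 / 2 * Real.log (h s) + 1 / 2 * Real.log (h s)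
      + geoError h s s) = 1 / (2 * Real.pi) * Real.log (h s) := by
    rw [geoError, if_pos rfl]; ring
  rw [h2] at h1
  refine h1.congr' ?_
  filter_upwards [self_mem_nhdsWithin] with t ht
  rw [greenRegular_eq (h := h) G ht]
  ring

end Vortex
end

open Vortex in
theorem mainTheorem4 (N : ℕ) (κ : Fin N → ℝ) (hκ : ∀ j, κ j ≠ 0) (hsum : ∑ j, κ j = 0)
    (h : S2 → ℝ) (hsmooth : ContMDiff (𝓡 2) 𝓘(ℝ, ℝ) ∞ h) (hpos : ∀ s, 0 < h s) :
    -- `Ω` is symplectic and `H` is smooth off the collisions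
    IsSymplecticForm (vortexForm h κ) ∧
    (∀ σ : Config N, Function.Injective σ →
      ContDiffAt ℝ ∞ (fun x => sphereHamiltonian h κ (retractAll x)) (incl σ)) ∧
    -- the velocity of the vortices is well defined, and it is the Hamiltonian vector field
    (∀ σ : Config N, Function.Injective σ →
      (∃! X : Fin N → E3, IsVortexVelocity h κ σ X) ∧
      ∀ X : Fin N → E3, IsVortexVelocity h κ σ X ↔
        IsHamiltonianVector (vortexForm h κ)
          (fun τ => sphereHamiltonian h κ τ / (2 * Real.pi)) σ X) ∧
    -- hence the vortex motions are the Hamiltonian motions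
    (∀ (γ : ℝ → Config N) (I : Set ℝ),
      IsMotion (IsVortexVelocity h κ) γ I ↔
        IsMotion (IsHamiltonianVector (vortexForm h κ)
          (fun τ => sphereHamiltonian h κ τ / (2 * Real.pi))) γ I) ∧
    -- the Hamiltonian is the collective one, of the Green and Robin functions of `h² g_o`
    (∀ G : S2 → S2 → ℝ, IsGreenFunction h G →
      ∃ R : S2 → ℝ, (∀ s, IsRobinValue h G s (R s)) ∧
        ∀ σ : Config N, Function.Injective σ →
          IsStreamFunction h κ σ (fun s => ∑ j, κ j * G s (σ j)) ∧
          collectiveHamiltonian κ G R σ = sphereHamiltonian h κ σ / (2 * Real.pi)) := by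
  have hiff : ∀ σ : Config N, Function.Injective σ → ∀ X : Fin N → E3,
      IsVortexVelocity h κ σ X ↔ IsHamiltonianVector (vortexForm h κ)
        (fun τ => sphereHamiltonian h κ τ / (2 * Real.pi)) σ X := fun σ hσ X =>
    (isVortexVelocity_iff hsmooth hpos hsum hσ X).trans
      (isHamiltonianVector_iff hsmooth hpos hκ hsum hσ X).symm
  refine ⟨isSymplecticForm_vortexForm hκ hsmooth hpos,
    fun σ hσ => contDiffAt_sphereHamiltonian hsmooth hpos κ hσ,
    fun σ hσ => ⟨⟨vortexVelocity h κ σ,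
      (isVortexVelocity_iff hsmooth hpos hsum hσ _).2 rfl,
      fun X hX => (isVortexVelocity_iff hsmooth hpos hsum hσ X).1 hX⟩, hiff σ hσ⟩,
    fun γ I => ?_, fun G hG => ?_⟩
  · refine forall₂_congr fun t _ => and_congr_right fun hσ => exists_congr fun X => ?_
    rw [hiff (γ t) hσ X]
  · obtain ⟨L, hL, hGL⟩ := hG.exists_greenRegular_eq hsmooth hpos
    exact ⟨fun s => L s - 1 / (2 * Real.pi) * Real.log (h s),
      fun s => isRobinValue_of_tendsto hsmooth hpos (hL s),
      fun σ hσ => ⟨hG.isStreamFunction hpos hsum hσ,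
        collectiveHamiltonian_eq hpos hsum hG hGL hσ⟩⟩
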